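/- **Nets.** A net $N=(S,T,F,M_0)$ consists of disjoint sets $S$ (places) and $T$ (transitions), a flow function $F:(S\times T)\cup(T\times S)\to\mathbb N$ and an initial marking $M_0:S\to\mathbb N$, such that for each $t\in T$ the set $\{s\mid F(s,t)>0\}$ is finite and non-empty and $\{s\mid F(t,s)>0\}$ is finite. It is countable if $S$ and $T$ are countable. We write ${}^\bullet x(y)=F(y,x)$ and $x^\bullet(y)=F(x,y)$, extended additively to multisets of transitions, and $F^+$ for the transitive closure of $\{(x,y)\mid F(x,y)>0\}$. A finite non-empty multiset $G$ of transitions can fire from a marking $M:S\to\mathbb N$ if ${}^\bullet G\le M$, leading to $M-{}^\bullet G+G^\bullet$. A marking is reachable if it is obtained from $M_0$ by firing a finite (possibly empty) sequence of single transitions. $N$ is *binary-conflict-free* if there are no reachable marking $M$ and multiset $G$ of exactly two transitions such that, for every $t\in G$, the restriction $G\upharpoonright\{t\}$ (with the multiplicity of $t$ in $G$) can fire from $M$ while $G$ cannot. **Processes.** A *GR-process* of $N$ is a pair $P=(\mathsf N,\pi)$ where $\mathsf N=(\mathsf S,\mathsf T,\mathsf F,\mathsf M_0)$ is a net with $|{}^\bullet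 s|\le 1$ and $|s^\bullet|\le 1$ for every $s\in\mathsf S$, with $\mathsf M_0(s)=1$ if ${}^\bullet s=\emptyset$ and $\mathsf M_0(s)=0$ otherwise, with $\mathsf F^+$ irreflexive, and with $\{t\mid (t,u)\in \mathsf F^+\}$ finite for all $u\in\mathsf T$; and $\pi$ maps $\mathsf S$ to $S$ and $\mathsf T$ to $T$ such that $M_0(s)=|\pi^{-1}(s)\cap \mathsf M_0|$, $F(s,\pi(t))=|\pi^{-1}(s)\cap{}^\bullet t|$ and $F(\pi(t),s)=|\pi^{-1}(s)\cap t^\bullet|$ for all $s\in S$, $t\in\mathsf T$. $P$ is finite if $\mathsf T$ is finite. $P'$ is a *prefix* of $P$, and $P$ an *extension* of $P'$, written $P'\le P$, if $\mathsf S'\subseteq\mathsf S$, $\mathsf T'\subseteq\mathsf T$, $\mathsf M_0'=\mathsf M_0$ (both being extended by $0$), and $\mathsf F',\pi'$ are the restrictions of $\mathsf F,\pi$. Processes are considered up to isomorphism (bijections of places and of transitions preserving flow, initial marking and $\pi$). **Swapping.** Let $p,q\in\mathsf S$ with $\pi(p)=\pi(q)$ and $(p,q),(q,p)\notin\mathsf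 F^+$; $\mathrm{swap}(P,p,q)$ is obtained from $P$ by exchanging the outgoing arcs of $p$ and $q$. Write $P\approx_s Q$ if $\mathrm{swap}(P,p,q)$ is isomorphic to $Q$ for some such $p,q$, write $\approx_s^*$ for the reflexive (up to isomorphism) and transitive closure of $\approx_s$, and $[P]$ for the $\approx_s^*$-class of a finite process $P$. Put $[P']\le[P]$ if $P'\approx_s^*Q'\le Q\approx_s^*P$ for some $Q',Q$. For any process $P$ let $BD(P)$ be the closure under $\le$-smaller classes of $\{[P']\mid P'\le P,\ P'\text{ finite}\}$, and write $P\approx_s^\infty Q$ if $BD(P)=BD(Q)$. A *BD-process* is a $\approx_s^\infty$-class $[P]_\infty$. A *BD-run* of $N$ is a non-empty set $\mathcal R$ of $\approx_s^*$-classes of finite processes that is closed under $\le$-smaller classes and in which any two elements have an upper bound in $\mathcal R$; it is maximal if no BD-run of $N$ properly contains it. The set $BD(P)$ is a BD-run. The BD-process $[P]_\infty$ is *maximal* if $P'\approx_s^\infty Q$ for all $P'\in[P]_\infty$ and all $Q$ with $P'\le Q$; it is *run-maximal* if $BD(P)$ is a maximal BD-run. **Lemma.** Let $N$ be a countable binary-conflict-free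 net and let $P$ be a GR-process of $N$. 1. If $BD(P)$ is not a maximal BD-run, then there are $P'\approx_s^\infty P$ and $Q$ with $P'\le Q$ and $P'\not\approx_s^\infty Q$. 2. If the BD-process $[P]_\infty$ is maximal, then it is run-maximal. -/

import Mathlib

universe u

/-- A net (place/transition system of finite synchronisation): places, transitions, the flow
relation with arc weights, given by `pre t s = F(s, t)` and `post t s = F(t, s)`, and the initial
marking. Every transition has a finite non-empty set of preplaces and a finite set of
postplaces. -/
structure PTNet where
  Place : Type u
  Trans : Type u
  pre : Trans → Place → ℕ
  post : Trans → Place → ℕ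
  init : Place → ℕ
  pre_finite : ∀ t, {s | 0 < pre t s}.Finite
  pre_nonempty : ∀ t, {s | 0 < pre t s}.Nonempty
  post_finite : ∀ t, {s | 0 < post t s}.Finite

namespace PTNet

/-- The multiset of preplaces of a finite multiset of transitions. -/
def preM (N : PTNet.{u}) (G : Multiset N.Trans) (s : N.Place) : ℕ :=
  (G.map fun t => N.pre t s).sum

/-- The multiset of postplaces of a finite multiset of transitions. -/
def postM (N : PTNet.{u}) (G : Multiset N.Trans) (s : N.Place) : ℕ :=
  (G.map fun t => N.post t s).sum

/-- The finite non-empty multiset `G` is a step from the marking `M` to the marking `M'`. -/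
def Step (N : PTNet.{u}) (M : N.Place → ℕ) (G : Multiset N.Trans) (M' : N.Place → ℕ) : Prop :=
  G ≠ 0 ∧ (∀ s, N.preM G s ≤ M s) ∧ ∀ s, M' s = M s - N.preM G s + N.postM G s

/-- `G` can fire from the marking `M`. -/
def CanFire (N : PTNet.{u}) (M : N.Place → ℕ) (G : Multiset N.Trans) : Prop :=
  ∃ M', N.Step M G M'

/-- `M` is reached from the initial marking by firing some finite word of transitions. -/
def Reachable (N : PTNet.{u}) (M : N.Place → ℕ) : Prop :=
  Relation.ReflTransGen (fun M₁ M₂ => ∃ t, N.Step M₁ {t} M₂) N.init M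

open Classical in
/-- `G` is in semantic conflict in `M`: for each `t ∈ G` the restriction of `G` to `t` (with the
multiplicity that `t` has in `G`) can fire from `M`, but `G` cannot. -/
def InConflict (N : PTNet.{u}) (M : N.Place → ℕ) (G : Multiset N.Trans) : Prop :=
  (∀ t ∈ G, N.CanFire M (Multiset.replicate (G.count t) t)) ∧ ¬ N.CanFire M G

/-- No multiset of exactly two transitions is in conflict in a reachable marking. -/
def BinaryConflictFree (N : PTNet.{u}) : Prop :=
  ∀ G : Multiset N.Trans, G.card = 2 → ∀ M, N.Reachable M → ¬ N.InConflict M G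

/-- Countably many places and countably many transitions. -/
def IsCountable (N : PTNet.{u}) : Prop :=
  Countable N.Place ∧ Countable N.Trans

/-- There is an arc from `x` to `y`. -/
def Arc (N : PTNet.{u}) : N.Place ⊕ N.Trans → N.Place ⊕ N.Trans → Prop
  | Sum.inl s, Sum.inr t => 0 < N.pre t s
  | Sum.inr t, Sum.inl s => 0 < N.post t s
  | Sum.inl _, Sum.inl _ => False
  | Sum.inr _, Sum.inr _ => False

/-- The transitive closure of the flow relation. -/
def FlowPlus (N : PTNet.{u}) : N.Place ⊕ N.Trans → N.Place ⊕ N.Trans → Prop :=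
  Relation.TransGen N.Arc

open Classical in
/-- The net obtained by exchanging the outgoing arcs of the places `p` and `q`. -/
noncomputable def swap (N : PTNet.{u}) (p q : N.Place) : PTNet.{u} where
  Place := N.Place
  Trans := N.Trans
  pre t s := if s = p then N.pre t q else if s = q then N.pre t p else N.pre t s
  post := N.post
  init := N.init
  pre_finite t := by
    refine ((N.pre_finite t).union (Set.toFinite {p, q})).subset ?_
    intro s hs
    by_cases h1 : s = p
    · exact Or.inr (by simp [h1])
    by_cases h2 : s = q
    · exact Or.inr (by simp [h2])
    · left
      simpa [h1, h2] using hs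
  pre_nonempty t := by
    obtain ⟨s, hs⟩ := N.pre_nonempty t
    by_cases h1 : s = p
    · subst h1
      refine ⟨q, ?_⟩
      by_cases h : q = s
      · subst h; simpa using hs
      · simpa [h] using hs
    by_cases h2 : s = q
    · subst h2
      exact ⟨p, by simpa using hs⟩
    · exact ⟨s, by simpa [h1, h2] using hs⟩
  post_finite := N.post_finite

end PTNet

/-- A GR-process of the net `N`: an occurrence net `net` together with a map (`mapS` on places,
`mapT` on transitions) to `N`. Places have at most one ingoing and at most one outgoing arc
(counted with arc weights), so that presets, postsets and the initial marking of `net` are sets,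
whose cardinalities are taken in `ℕ∞`. -/
structure GRProc (N : PTNet.{u}) where
  net : PTNet.{u}
  mapS : net.Place → N.Place
  mapT : net.Trans → N.Trans
  post_le_one : ∀ s t, net.post t s ≤ 1
  post_unique : ∀ s t t', 0 < net.post t s → 0 < net.post t' s → t = t'
  pre_le_one : ∀ s t, net.pre t s ≤ 1
  pre_unique : ∀ s t t', 0 < net.pre t s → 0 < net.pre t' s → t = t'
  init_eq_one : ∀ s, (∀ t, net.post t s = 0) → net.init s = 1
  init_eq_zero : ∀ s, (∃ t, 0 < net.post t s) → net.init s = 0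
  acyclic : ∀ x, ¬ net.FlowPlus x x
  finite_past : ∀ u : net.Trans, {t : net.Trans | net.FlowPlus (Sum.inr t) (Sum.inr u)}.Finite
  map_init : ∀ s, (N.init s : ℕ∞) = {x | mapS x = s ∧ net.init x = 1}.encard
  map_pre : ∀ t s, (N.pre (mapT t) s : ℕ∞) = {x | mapS x = s ∧ 0 < net.pre t x}.encard
  map_post : ∀ t s, (N.post (mapT t) s : ℕ∞) = {x | mapS x = s ∧ 0 < net.post t x}.encard

/-- `(n₁, π₁)` and `(n₂, π₂)`, nets with maps to `N`, are isomorphic: there is a net isomorphism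
from `n₁` to `n₂` that respects the maps. -/
def LabelledIso {N : PTNet.{u}} (n₁ : PTNet.{u}) (πS₁ : n₁.Place → N.Place)
    (πT₁ : n₁.Trans → N.Trans) (n₂ : PTNet.{u}) (πS₂ : n₂.Place → N.Place)
    (πT₂ : n₂.Trans → N.Trans) : Prop :=
  ∃ (f : n₁.Place ≃ n₂.Place) (g : n₁.Trans ≃ n₂.Trans),
    (∀ s, n₂.init (f s) = n₁.init s) ∧
    (∀ t s, n₂.pre (g t) (f s) = n₁.pre t s) ∧
    (∀ t s, n₂.post (g t) (f s) = n₁.post t s) ∧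
    (∀ s, πS₂ (f s) = πS₁ s) ∧ (∀ t, πT₂ (g t) = πT₁ t)

namespace GRProc

variable {N : PTNet.{u}}

/-- Isomorphism of processes. -/
def Iso (P Q : GRProc N) : Prop :=
  LabelledIso P.net P.mapS P.mapT Q.net Q.mapS Q.mapT

/-- A process is finite if it has finitely many transitions. -/
def IsFinite (P : GRProc N) : Prop :=
  Finite P.net.Trans

/-- `P'` is a prefix of `P` (`P` is an extension of `P'`). Carriers being types, the inclusions of
places and transitions are rendered by injections; `P` has the same initial marking, flow and map
to `N` on their images, and no initial token outside. -/
def Prefix (P' P : GRProc N) : Prop :=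
  ∃ (f : P'.net.Place → P.net.Place) (g : P'.net.Trans → P.net.Trans),
    Function.Injective f ∧ Function.Injective g ∧
    (∀ s, P.net.init (f s) = P'.net.init s) ∧
    (∀ s, s ∉ Set.range f → P.net.init s = 0) ∧
    (∀ t s, P.net.pre (g t) (f s) = P'.net.pre t s) ∧
    (∀ t s, P.net.post (g t) (f s) = P'.net.post t s) ∧
    (∀ s, P.mapS (f s) = P'.mapS s) ∧ (∀ t, P.mapT (g t) = P'.mapT t)

/-- One step swapping equivalence: for some causally unrelated places `p` and `q` of `P` with the
same image in `N`, the process `swap(P, p, q)` is isomorphic to `Q`. -/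
def SwapStep (P Q : GRProc N) : Prop :=
  ∃ p q : P.net.Place,
    ¬ P.net.FlowPlus (Sum.inl p) (Sum.inl q) ∧ ¬ P.net.FlowPlus (Sum.inl q) (Sum.inl p) ∧
    P.mapS p = P.mapS q ∧
    LabelledIso (P.net.swap p q) P.mapS P.mapT Q.net Q.mapS Q.mapT

/-- The reflexive and transitive closure of one step swapping equivalence, processes being
identified up to isomorphism. (Isomorphic processes that have a place `p` are one step swapping
equivalent, through `p = q`; the first disjunct matters only for processes without places.) -/
def SwapStar : GRProc N → GRProc N → Prop :=
  Relation.ReflTransGen fun P Q => Iso P Q ∨ SwapStep P Q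

theorem flowPlus_swap {n : PTNet.{u}} {p q x : n.Place} {z : n.Place ⊕ n.Trans}
    (hx : x = p ∨ x = q) (h : (n.swap p q).FlowPlus (Sum.inl x) z) :
    n.FlowPlus (Sum.inl p) z ∨ n.FlowPlus (Sum.inl q) z := by
  have key : ∀ (s : n.Place) (t : n.Trans), (s = p ∨ s = q) → 0 < (n.swap p q).pre t s →
      n.Arc (Sum.inl p) (Sum.inr t) ∨ n.Arc (Sum.inl q) (Sum.inr t) := by
    intro s t hs h
    simp only [PTNet.swap] at h
    rcases hs with rfl | rfl
    · right; simpa [PTNet.Arc] using h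
    · by_cases e : s = p
      · right; simpa [PTNet.Arc, e] using h
      · left; simpa [PTNet.Arc, e] using h
  have lift : ∀ z, n.Arc (Sum.inl p) z ∨ n.Arc (Sum.inl q) z →
      n.FlowPlus (Sum.inl p) z ∨ n.FlowPlus (Sum.inl q) z := fun z h =>
    h.imp (fun h => Relation.TransGen.single h) (fun h => Relation.TransGen.single h)
  unfold PTNet.FlowPlus at h
  induction h with
  | single h =>
    rename_i b
    cases b with
    | inl s => exact h.elim
    | inr t => exact lift _ (key _ _ hx h)
  | tail h1 h2 ih =>
    rename_i b c
    cases b with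
    | inl s =>
      cases c with
      | inl s' => exact h2.elim
      | inr t =>
        by_cases e : s = p ∨ s = q
        · exact lift _ (key _ _ e h2)
        · have h3 : n.Arc (Sum.inl s) (Sum.inr t) := by
            have h4 : 0 < (n.swap p q).pre t s := h2
            rw [not_or] at e
            simpa [PTNet.swap, PTNet.Arc, e.1, e.2] using h4
          exact ih.imp (fun h => Relation.TransGen.tail h h3)
            (fun h => Relation.TransGen.tail h h3)
    | inr t =>
      cases c with
      | inl s =>
        have h3 : n.Arc (Sum.inr t) (Sum.inl s) := h2
        exact ih.imp (fun h => Relation.TransGen.tail h h3)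
          (fun h => Relation.TransGen.tail h h3)
      | inr t' => exact h2.elim

theorem Iso.symm {P Q : GRProc N} (h : Iso P Q) : Iso Q P := by
  obtain ⟨f, g, h1, h2, h3, h4, h5⟩ := h
  refine ⟨f.symm, g.symm, ?_, ?_, ?_, ?_, ?_⟩
  · intro s; simpa using (h1 (f.symm s)).symm
  · intro t s; simpa using (h2 (g.symm t) (f.symm s)).symm
  · intro t s; simpa using (h3 (g.symm t) (f.symm s)).symm
  · intro s; simpa using (h4 (f.symm s)).symm
  · intro t; simpa using (h5 (g.symm t)).symm

theorem SwapStep.symm {P Q : GRProc N} (h : SwapStep P Q) : SwapStep Q P := by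
  obtain ⟨p, q, hpq, hqp, hπ, f, g, h1, h2, h3, h4, h5⟩ := h
  change P.net.Place ≃ Q.net.Place at f
  change P.net.Trans ≃ Q.net.Trans at g
  change ∀ s : P.net.Place, Q.net.init (f s) = P.net.init s at h1
  change ∀ (t : P.net.Trans) (s : P.net.Place),
    Q.net.pre (g t) (f s) = (P.net.swap p q).pre t s at h2
  change ∀ (t : P.net.Trans) (s : P.net.Place), Q.net.post (g t) (f s) = P.net.post t s at h3
  change ∀ s : P.net.Place, Q.mapS (f s) = P.mapS s at h4
  change ∀ t : P.net.Trans, Q.mapT (g t) = P.mapT t at h5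
  have back : ∀ x y, Q.net.FlowPlus x y →
      (P.net.swap p q).FlowPlus (Sum.map f.symm g.symm x) (Sum.map f.symm g.symm y) := by
    intro x y hxy
    unfold PTNet.FlowPlus at hxy
    have step : ∀ x y, Q.net.Arc x y →
        (P.net.swap p q).Arc (Sum.map f.symm g.symm x) (Sum.map f.symm g.symm y) := by
      rintro (s | t) (s' | t') h
      · exact h.elim
      · have := h2 (g.symm t') (f.symm s)
        simp only [Equiv.apply_symm_apply] at this
        exact lt_of_lt_of_eq (h : 0 < Q.net.pre t' s) this
      · have := h3 (g.symm t) (f.symm s')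
        simp only [Equiv.apply_symm_apply] at this
        exact lt_of_lt_of_eq (h : 0 < Q.net.post t s') this
      · exact h.elim
    induction hxy with
    | single h => exact Relation.TransGen.single (step _ _ h)
    | tail _ h ih => exact Relation.TransGen.tail ih (step _ _ h)
  refine ⟨f p, f q, ?_, ?_, ?_, f.symm, g.symm, ?_, ?_, ?_, ?_, ?_⟩
  · intro h
    have h' : (P.net.swap p q).FlowPlus (Sum.inl (f.symm (f p))) (Sum.inl (f.symm (f q))) :=
      back _ _ h
    rw [f.symm_apply_apply, f.symm_apply_apply] at h'
    rcases flowPlus_swap (n := P.net) (p := p) (q := q) (x := p) (Or.inl rfl) h' with h | h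
    · exact hpq h
    · exact P.acyclic _ h
  · intro h
    have h' : (P.net.swap p q).FlowPlus (Sum.inl (f.symm (f q))) (Sum.inl (f.symm (f p))) :=
      back _ _ h
    rw [f.symm_apply_apply, f.symm_apply_apply] at h'
    rcases flowPlus_swap (n := P.net) (p := p) (q := q) (x := q) (Or.inr rfl) h' with h | h
    · exact P.acyclic _ h
    · exact hqp h
  · rw [h4, h4, hπ]
  · intro s
    obtain ⟨s, rfl⟩ := f.surjective s
    exact (congrArg P.net.init (f.symm_apply_apply s)).trans (h1 s).symm
  · intro t s
    obtain ⟨s, rfl⟩ := f.surjective s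
    obtain ⟨t, rfl⟩ := g.surjective t
    refine (congrArg₂ P.net.pre (g.symm_apply_apply t) (f.symm_apply_apply s)).trans ?_
    simp only [PTNet.swap, f.apply_eq_iff_eq, h2]
    split_ifs <;> simp_all
  · intro t s
    obtain ⟨s, rfl⟩ := f.surjective s
    obtain ⟨t, rfl⟩ := g.surjective t
    exact (congrArg₂ P.net.post (g.symm_apply_apply t) (f.symm_apply_apply s)).trans
      (h3 t s).symm
  · intro s
    obtain ⟨s, rfl⟩ := f.surjective s
    exact (congrArg P.mapS (f.symm_apply_apply s)).trans (h4 s).symm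
  · intro t
    obtain ⟨t, rfl⟩ := g.surjective t
    exact (congrArg P.mapT (g.symm_apply_apply t)).trans (h5 t).symm

theorem SwapStar.symm {P Q : GRProc N} (h : SwapStar P Q) : SwapStar Q P := by
  unfold SwapStar at h
  induction h with
  | refl => exact Relation.ReflTransGen.refl
  | tail _ h ih => exact Relation.ReflTransGen.head (h.imp Iso.symm SwapStep.symm) ih

end GRProc

/-- The finite GR-processes of `N`. -/
def FinGRProc (N : PTNet.{u}) : Type (u + 1) :=
  {P : GRProc N // P.IsFinite}

/-- Finite GR-processes up to `GRProc.SwapStar`. -/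
def finSwapSetoid (N : PTNet.{u}) : Setoid (FinGRProc N) where
  r P Q := GRProc.SwapStar P.1 Q.1
  iseqv := ⟨fun _ => Relation.ReflTransGen.refl, fun h => GRProc.SwapStar.symm h,
    fun h h' => Relation.ReflTransGen.trans h h'⟩

/-- Finite BD-processes: swapping equivalence classes of finite GR-processes. -/
def FinBD (N : PTNet.{u}) : Type (u + 1) :=
  Quotient (finSwapSetoid N)

/-- The swapping equivalence class of a finite GR-process. -/
def FinBD.mk {N : PTNet.{u}} (P : GRProc N) (hP : P.IsFinite) : FinBD N :=
  Quotient.mk (finSwapSetoid N) ⟨P, hP⟩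

/-- The prefix relation between classes: some representatives are in the prefix relation. -/
def FinBD.Le {N : PTNet.{u}} (a b : FinBD N) : Prop :=
  ∃ (Q' Q : GRProc N) (hQ' : Q'.IsFinite) (hQ : Q.IsFinite),
    a = FinBD.mk Q' hQ' ∧ Q'.Prefix Q ∧ b = FinBD.mk Q hQ

/-- BD-runs: non-empty, prefix-closed, directed sets of finite BD-processes. -/
structure IsBDRun {N : PTNet.{u}} (R : Set (FinBD N)) : Prop where
  nonempty : R.Nonempty
  prefix_closed : ∀ a b, FinBD.Le a b → b ∈ R → a ∈ R
  directed : ∀ a ∈ R, ∀ b ∈ R, ∃ c ∈ R, FinBD.Le a c ∧ FinBD.Le b c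

/-- A maximal BD-run: a BD-run that no other BD-run properly includes. -/
def IsMaximalBDRun {N : PTNet.{u}} (R : Set (FinBD N)) : Prop :=
  IsBDRun R ∧ ∀ R' : Set (FinBD N), IsBDRun R' → R ⊆ R' → R' = R

namespace GRProc

variable {N : PTNet.{u}}

/-- `BD(P)`: the prefix closure of the set of classes of the finite prefixes of `P`. -/
def toRun (P : GRProc N) : Set (FinBD N) :=
  {a | ∃ (P' : GRProc N) (hP' : P'.IsFinite), P'.Prefix P ∧ FinBD.Le a (FinBD.mk P' hP')}

/-- Swapping equivalence of (possibly infinite) processes. -/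
def SwapEquiv (P Q : GRProc N) : Prop :=
  P.toRun = Q.toRun

end GRProc

/-- Swapping equivalence as a setoid. -/
def swapSetoid (N : PTNet.{u}) : Setoid (GRProc N) where
  r := GRProc.SwapEquiv
  iseqv := ⟨fun _ => rfl, fun h => Eq.symm h, fun h h' => Eq.trans h h'⟩

/-- BD-processes: swapping equivalence classes of GR-processes. -/
def BDProc (N : PTNet.{u}) : Type (u + 1) :=
  Quotient (swapSetoid N)

namespace BDProc

variable {N : PTNet.{u}}

/-- The BD-process of a GR-process. -/
def mk (P : GRProc N) : BDProc N :=
  Quotient.mk (swapSetoid N) P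

/-- The BD-run of a BD-process. -/
def toRun (B : BDProc N) : Set (FinBD N) :=
  Quotient.lift GRProc.toRun (fun _ _ h => h) B

/-- A BD-process is maximal if every extension of every member is swapping equivalent to it. -/
def IsMaximal (B : BDProc N) : Prop :=
  ∀ P' : GRProc N, mk P' = B → ∀ Q : GRProc N, P'.Prefix Q → P'.SwapEquiv Q

/-- A BD-process is run-maximal if its BD-run is maximal. -/
def IsRunMaximal (B : BDProc N) : Prop :=
  IsMaximalBDRun B.toRun

end BDProc

/-! If `BD(P)` is not maximal, some finite process `A` has its class outside `BD(P)`: otherwise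
`BD(P)` would contain every class, and no run could be larger. Removing causally maximal transitions
from `A` one at a time must lead into `BD(P)`, since a process without transitions is a prefix of
every process. So `A` may be chosen such that `A` without some maximal transition `t`, call it `B`,
has its class in `BD(P)`. Swaps of a finite prefix extend to the whole process without changing its
run, so `B` may also be taken to be an actual prefix of `P` (`exists_prefix_of_mem_toRun`).

Linearise `P` with the transitions of `B` first (`exists_rank`). The places `X` that `t` would
consume are marked after `B`. Follow the later transitions `v` in order, keeping `X` marked. Cuts
are reachable markings (`exists_reachable`), and swaps inside a cut let `v` consume any places of
the cut with the right labels (`exists_retarget`). If `v` has the label of `t`, it can be made to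
consume `X`; then `B` together with `v` is a copy of `A` inside a process with the run of `P`, which
is impossible. If the labels differ, binary-conflict-freeness provides enough tokens for both, so
`v` can be redirected to places outside `X` (`Avoids.step`).

Each preset is final once its transition has been treated, so these infinitely many swaps have a
limit. Its initial segments are swapping equivalent to those of `P`, hence it has the same run
(`exists_rePre_avoiding`). Nothing in the limit consumes `X`, so `t` can be added
(`exists_extension`). The extension has `A` as a prefix, and therefore a different run. The
statement on BD-processes follows by contraposition. -/

namespace PTNet

/-! ### Rankings and the flow relation under swaps. -/

/-- The net `n` with its presets replaced by `pr`. -/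
abbrev rePre (n : PTNet.{u}) (pr : n.Trans → n.Place → ℕ) (hf : ∀ t, {s | 0 < pr t s}.Finite)
    (hn : ∀ t, {s | 0 < pr t s}.Nonempty) : PTNet.{u} :=
  { n with pre := pr, pre_finite := hf, pre_nonempty := hn }

/-- `r` strictly increases along the flow from transition to transition. -/
def Ranks (n : PTNet.{u}) (r : n.Trans → ℕ) : Prop :=
  ∀ t x v, 0 < n.post t x → 0 < n.pre v x → r t < r v

/-- What a ranking says about a causally ordered pair of elements. -/
def RankRel (n : PTNet.{u}) (r : n.Trans → ℕ) : n.Place ⊕ n.Trans → n.Place ⊕ n.Trans → Prop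
  | Sum.inr t, Sum.inr v => r t < r v
  | Sum.inr t, Sum.inl s => ∃ v, 0 < n.post v s ∧ r t ≤ r v
  | Sum.inl s, Sum.inr t => ∃ v, 0 < n.pre v s ∧ r v ≤ r t
  | Sum.inl s, Sum.inl s' => ∃ v w, 0 < n.pre v s ∧ 0 < n.post w s' ∧ r v ≤ r w

/-- Induction along the path: the rank grows whenever the path passes from the producer of a place
to its consumer. A path that starts or ends in a place is measured at a consumer of the first place
or a producer of the last. -/
theorem Ranks.rel {n : PTNet.{u}} {r : n.Trans → ℕ} (hr : n.Ranks r)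
    {x y : n.Place ⊕ n.Trans} (h : n.FlowPlus x y) : n.RankRel r x y := by
  unfold FlowPlus at h
  induction h with
  | single h =>
    rename_i b
    rcases x with s | t <;> rcases b with s' | t'
    · exact h.elim
    · exact ⟨t', h, le_rfl⟩
    · exact ⟨t, h, le_rfl⟩
    · exact h.elim
  | tail h0 h2 ih =>
    rename_i b c
    rcases b with s | t <;> rcases c with s' | t'
    · exact h2.elim
    · rcases x with a | a
      · obtain ⟨v, w, h1, h3, h4⟩ := ih
        exact ⟨v, h1, h4.trans (hr _ _ _ h3 h2).le⟩
      · obtain ⟨v, h1, h3⟩ := ih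
        exact h3.trans_lt (hr _ _ _ h1 h2)
    · rcases x with a | a
      · obtain ⟨v, h1, h3⟩ := ih
        exact ⟨v, t, h1, h2, h3⟩
      · exact ⟨t, h2, le_of_lt ih⟩
    · exact h2.elim

theorem Ranks.acyclic {n : PTNet.{u}} {r : n.Trans → ℕ} (hr : n.Ranks r)
    (x : n.Place ⊕ n.Trans) : ¬ n.FlowPlus x x := by
  intro h
  have h := hr.rel h
  rcases x with s | t
  · obtain ⟨v, w, h1, h2, h3⟩ := h
    exact absurd (hr _ _ _ h2 h1) (not_lt.2 h3)
  · exact lt_irrefl _ (h : r t < r t)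

theorem Ranks.finite_past {n : PTNet.{u}} {r : n.Trans → ℕ} (hr : n.Ranks r)
    (hf : ∀ i, {t | r t < i}.Finite) (v : n.Trans) :
    {t : n.Trans | n.FlowPlus (Sum.inr t) (Sum.inr v)}.Finite :=
  (hf (r v)).subset fun _ ht => hr.rel ht

open Classical in
theorem swap_pre (n : PTNet.{u}) (p q : n.Place) (t : n.Trans) (s : n.Place) :
    (n.swap p q).pre t s = n.pre t (Equiv.swap p q s) := by
  rw [Equiv.swap_apply_def]
  simp only [swap]
  split_ifs <;> rfl

/-- A path that never leaves `p` or `q` uses old arcs only. Otherwise cut it at its first and its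
last exit from these places: the segment before the first and the segment after the last are, up to
which of `p` and `q` is left, paths of the original net. -/
theorem flowPlus_of_swap {n : PTNet.{u}} {p q : n.Place} {x y : n.Place ⊕ n.Trans}
    (h : (n.swap p q).FlowPlus x y) :
    n.FlowPlus x y ∨ ((x = Sum.inl p ∨ x = Sum.inl q ∨ n.FlowPlus x (Sum.inl p) ∨
      n.FlowPlus x (Sum.inl q)) ∧ (n.FlowPlus (Sum.inl p) y ∨ n.FlowPlus (Sum.inl q) y)) := by
  have arc : ∀ a b : n.Place ⊕ n.Trans, (n.swap p q).Arc a b →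
      (a ≠ Sum.inl p → a ≠ Sum.inl q → n.Arc a b) ∧ ((a = Sum.inl p ∨ a = Sum.inl q) →
        n.FlowPlus (Sum.inl p) b ∨ n.FlowPlus (Sum.inl q) b) := by
    intro a b hab
    refine ⟨fun h1 h2 => ?_, ?_⟩
    · rcases a with s | t <;> rcases b with s' | t'
      · exact hab.elim
      · have h3 : 0 < (n.swap p q).pre t' s := hab
        have h1 : s ≠ p := fun e => h1 (e ▸ rfl)
        have h2 : s ≠ q := fun e => h2 (e ▸ rfl)
        simpa [swap, Arc, h1, h2] using h3
      · exact hab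
      · exact hab.elim
    · rintro (rfl | rfl)
      · exact GRProc.flowPlus_swap (Or.inl rfl) (Relation.TransGen.single hab)
      · exact GRProc.flowPlus_swap (Or.inr rfl) (Relation.TransGen.single hab)
  unfold FlowPlus at h
  induction h with
  | single h =>
    by_cases h1 : x = Sum.inl p ∨ x = Sum.inl q
    · exact Or.inr ⟨by tauto, (arc _ _ h).2 h1⟩
    · rw [not_or] at h1
      exact Or.inl (Relation.TransGen.single ((arc _ _ h).1 h1.1 h1.2))
  | tail h0 h2 ih =>
    rename_i b c
    by_cases h1 : b = Sum.inl p ∨ b = Sum.inl q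
    · refine Or.inr ⟨?_, (arc _ _ h2).2 h1⟩
      rcases ih with ih | ih
      · rcases h1 with rfl | rfl
        · exact Or.inr (Or.inr (Or.inl ih))
        · exact Or.inr (Or.inr (Or.inr ih))
      · exact ih.1
    · rw [not_or] at h1
      have h3 := (arc _ _ h2).1 h1.1 h1.2
      rcases ih with ih | ⟨ih1, ih2⟩
      · exact Or.inl (Relation.TransGen.tail ih h3)
      · exact Or.inr ⟨ih1, ih2.imp (fun h => Relation.TransGen.tail h h3)
          fun h => Relation.TransGen.tail h h3⟩

end PTNet

/-! ### Processes that differ only in their presets. -/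

namespace GRProc

variable {N : PTNet.{u}}

/-- `pr` can replace the presets of the process `P`. -/
structure IsPre (P : GRProc N) (pr : P.net.Trans → P.net.Place → ℕ) : Prop where
  fin : ∀ t, {s | 0 < pr t s}.Finite
  ne : ∀ t, {s | 0 < pr t s}.Nonempty
  le_one : ∀ s t, pr t s ≤ 1
  unique : ∀ s t t', 0 < pr t s → 0 < pr t' s → t = t'
  acyclic : ∀ x, ¬ (P.net.rePre pr fin ne).FlowPlus x x
  finite_past : ∀ v : P.net.Trans,
    {t : P.net.Trans | (P.net.rePre pr fin ne).FlowPlus (Sum.inr t) (Sum.inr v)}.Finite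
  map_pre : ∀ t s, (N.pre (P.mapT t) s : ℕ∞) = {x | P.mapS x = s ∧ 0 < pr t x}.encard

/-- The process `P` with its presets replaced by `pr`. -/
abbrev rePre (P : GRProc N) (pr : P.net.Trans → P.net.Place → ℕ) (h : P.IsPre pr) : GRProc N :=
  { P with
    net := P.net.rePre pr h.fin h.ne
    pre_le_one := h.le_one
    pre_unique := h.unique
    acyclic := h.acyclic
    finite_past := h.finite_past
    map_pre := h.map_pre }

theorem isPre_self (P : GRProc N) : P.IsPre P.net.pre :=
  ⟨P.net.pre_finite, P.net.pre_nonempty, P.pre_le_one, P.pre_unique, P.acyclic, P.finite_past,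
    P.map_pre⟩

theorem finite_past_place (P : GRProc N) (p : P.net.Place) :
    {t : P.net.Trans | P.net.FlowPlus (Sum.inr t) (Sum.inl p)}.Finite := by
  have key : ∀ t, P.net.FlowPlus (Sum.inr t) (Sum.inl p) → ∃ v, 0 < P.net.post v p ∧
      (t = v ∨ P.net.FlowPlus (Sum.inr t) (Sum.inr v)) := by
    intro t h
    unfold PTNet.FlowPlus at h
    rcases Relation.TransGen.tail'_iff.1 h with ⟨b, h1, h2⟩
    rcases b with s | v
    · exact h2.elim
    · refine ⟨v, h2, ?_⟩
      rcases Relation.reflTransGen_iff_eq_or_transGen.1 h1 with h | h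
      · exact Or.inl (Sum.inr_injective h).symm
      · exact Or.inr h
  by_cases hp : ∃ v, 0 < P.net.post v p
  · obtain ⟨v, hv⟩ := hp
    refine ((Set.finite_singleton v).union (P.finite_past v)).subset ?_
    intro t ht
    obtain ⟨w, hw, h⟩ := key t ht
    obtain rfl := P.post_unique _ _ _ hv hw
    exact h
  · refine Set.finite_empty.subset ?_
    intro t ht
    obtain ⟨w, hw, h⟩ := key t ht
    exact hp ⟨w, hw⟩

open Classical in
-- A new cycle would, by `flowPlus_of_swap`, yield an old path among `p` and `q`, against acyclicity
-- or causal independence. New causal predecessors of a transition all precede `p` or `q`, so pasts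
-- stay finite.
theorem isPre_swap (P : GRProc N) {p q : P.net.Place}
    (hpq : ¬ P.net.FlowPlus (Sum.inl p) (Sum.inl q))
    (hqp : ¬ P.net.FlowPlus (Sum.inl q) (Sum.inl p)) (hl : P.mapS p = P.mapS q) :
    P.IsPre (P.net.swap p q).pre where
  fin := (P.net.swap p q).pre_finite
  ne := (P.net.swap p q).pre_nonempty
  le_one s t := by
    have := P.pre_le_one (Equiv.swap p q s) t
    rwa [← PTNet.swap_pre] at this
  unique s t t' h h' := by
    rw [PTNet.swap_pre] at h h'
    exact P.pre_unique _ _ _ h h'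
  acyclic x h := by
    rcases PTNet.flowPlus_of_swap (n := P.net) h with h | ⟨h1, h2⟩
    · exact P.acyclic _ h
    · rcases h1 with rfl | rfl | h1 | h1 <;> rcases h2 with h2 | h2
      · exact P.acyclic _ h2
      · exact hqp h2
      · exact hpq h2
      · exact P.acyclic _ h2
      · exact P.acyclic _ (Relation.TransGen.trans h1 h2)
      · exact hqp (Relation.TransGen.trans h2 h1)
      · exact hpq (Relation.TransGen.trans h2 h1)
      · exact P.acyclic _ (Relation.TransGen.trans h1 h2)
  finite_past v := by
    refine ((P.finite_past v).union ((P.finite_past_place p).union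
      (P.finite_past_place q))).subset ?_
    intro t ht
    rcases PTNet.flowPlus_of_swap (n := P.net) ht with h | ⟨h1, -⟩
    · exact Or.inl h
    · rcases h1 with h1 | h1 | h1 | h1
      · cases h1
      · cases h1
      · exact Or.inr (Or.inl h1)
      · exact Or.inr (Or.inr h1)
  map_pre t s := by
    -- Transposing `p` and `q` preserves labels and carries the old preset to the new one.
    rw [P.map_pre, ← (Equiv.swap p q).injective.encard_image]
    congr 1
    ext x
    have hm : P.mapS (Equiv.swap p q x) = P.mapS x := by
      rw [Equiv.swap_apply_def]
      split_ifs with h1 h2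
      · rw [h1, hl]
      · rw [h2, hl]
      · rfl
    simp only [Set.mem_image, Set.mem_ofPred_eq]
    constructor
    · rintro ⟨y, ⟨h1, h2⟩, rfl⟩
      rw [PTNet.swap_pre, Equiv.swap_apply_self]
      refine ⟨?_, h2⟩
      rw [← h1, ← hm, Equiv.swap_apply_self]
    · rintro ⟨h1, h2⟩
      refine ⟨Equiv.swap p q x, ⟨by rw [hm, h1], ?_⟩, Equiv.swap_apply_self _ _ _⟩
      rwa [PTNet.swap_pre] at h2

theorem swapStep_rePre (P : GRProc N) {p q : P.net.Place}
    (hpq : ¬ P.net.FlowPlus (Sum.inl p) (Sum.inl q))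
    (hqp : ¬ P.net.FlowPlus (Sum.inl q) (Sum.inl p)) (hl : P.mapS p = P.mapS q) :
    SwapStep P (P.rePre _ (P.isPre_swap hpq hqp hl)) :=
  ⟨p, q, hpq, hqp, hl, Equiv.refl _, Equiv.refl _, fun _ => rfl, fun _ _ => rfl, fun _ _ => rfl,
    fun _ => rfl, fun _ => rfl⟩

theorem init_eq_one_iff (P : GRProc N) (x : P.net.Place) :
    P.net.init x = 1 ↔ ∀ t, P.net.post t x = 0 := by
  refine ⟨fun h t => ?_, P.init_eq_one x⟩
  by_contra hc
  have := P.init_eq_zero x ⟨t, Nat.pos_of_ne_zero hc⟩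
  omega

theorem isInit_or (P : GRProc N) (x : P.net.Place) :
    P.net.init x = 1 ∨ ∃ t, 0 < P.net.post t x := by
  by_cases h : ∃ t, 0 < P.net.post t x
  · exact Or.inr h
  · left
    rw [init_eq_one_iff]
    push Not at h
    exact fun t => Nat.le_zero.1 (h t)

theorem finite_label_pre (P : GRProc N) (t : P.net.Trans) (s : N.Place) :
    {x | P.mapS x = s ∧ 0 < P.net.pre t x}.Finite :=
  (P.net.pre_finite t).subset fun _ h => h.2

end GRProc

theorem Set.encard_subtype_setOf {α : Type*} {S : α → Prop} (Q : α → Prop)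
    (h : ∀ a, Q a → S a) : {x : {a // S a} | Q x.1}.encard = {a | Q a}.encard := by
  rw [← Subtype.val_injective.encard_image]
  congr 1
  ext a
  exact ⟨fun ⟨x, hx, e⟩ => e ▸ hx, fun ha => ⟨⟨a, h a ha⟩, ha, rfl⟩⟩

theorem PTNet.FlowPlus.map {n m : PTNet.{u}} {f : n.Place → m.Place} {g : n.Trans → m.Trans}
    (hpre : ∀ t x, 0 < n.pre t x → 0 < m.pre (g t) (f x))
    (hpost : ∀ t x, 0 < n.post t x → 0 < m.post (g t) (f x)) {a b : n.Place ⊕ n.Trans}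
    (h : n.FlowPlus a b) : m.FlowPlus (Sum.map f g a) (Sum.map f g b) := by
  have arc : ∀ a b, n.Arc a b → m.Arc (Sum.map f g a) (Sum.map f g b) := by
    rintro (a | a) (b | b) h
    exacts [h, hpre _ _ h, hpost _ _ h, h]
  unfold PTNet.FlowPlus at h
  induction h with
  | single h => exact Relation.TransGen.single (arc _ _ h)
  | tail _ h ih => exact Relation.TransGen.tail ih (arc _ _ h)

/-! ### Causally closed parts and prefixes. -/

namespace GRProc

variable {N : PTNet.{u}}

/-- `D` contains all transitions that produce a preplace of a transition of `D`. -/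
def DownClosed (P : GRProc N) (D : Set P.net.Trans) : Prop :=
  ∀ t x v, 0 < P.net.post t x → 0 < P.net.pre v x → v ∈ D → t ∈ D

/-- The initial places and the postplaces of the transitions in `D`. -/
def InPlaces (P : GRProc N) (D : Set P.net.Trans) (x : P.net.Place) : Prop :=
  P.net.init x = 1 ∨ ∃ t ∈ D, 0 < P.net.post t x

theorem InPlaces.mem {P : GRProc N} {D : Set P.net.Trans} {x : P.net.Place} (h : P.InPlaces D x)
    {t : P.net.Trans} (ht : 0 < P.net.post t x) : t ∈ D := by
  rcases h with h | ⟨v, hv, h⟩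
  · rw [init_eq_one_iff] at h
    exact absurd (h t) ht.ne'
  · exact P.post_unique _ _ _ ht h ▸ hv

theorem InPlaces.mono {P : GRProc N} {D D' : Set P.net.Trans} (hD : D ⊆ D') {x : P.net.Place}
    (h : P.InPlaces D x) : P.InPlaces D' x :=
  h.imp id fun ⟨t, ht, h⟩ => ⟨t, hD ht, h⟩

theorem inPlaces_of_producers {P : GRProc N} {D : Set P.net.Trans} {x : P.net.Place}
    (h : ∀ t, 0 < P.net.post t x → t ∈ D) : P.InPlaces D x :=
  (P.isInit_or x).imp id fun ⟨t, ht⟩ => ⟨t, h t ht, ht⟩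

theorem DownClosed.inPlaces {P : GRProc N} {D : Set P.net.Trans} (hD : P.DownClosed D)
    {t : P.net.Trans} (ht : t ∈ D) {x : P.net.Place} (h : 0 < P.net.pre t x) : P.InPlaces D x :=
  inPlaces_of_producers fun _ hv => hD _ _ _ hv h ht

/-- The part of `P` whose transitions are those in `D`. -/
abbrev restrict (P : GRProc N) (D : Set P.net.Trans) (hD : P.DownClosed D) : GRProc N where
  net :=
    { Place := {x // P.InPlaces D x}
      Trans := {t // t ∈ D}
      pre := fun t x => P.net.pre t.1 x.1
      post := fun t x => P.net.post t.1 x.1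
      init := fun x => P.net.init x.1
      pre_finite := fun t => Set.Finite.preimage (f := Subtype.val)
        Subtype.val_injective.injOn (P.net.pre_finite t.1)
      pre_nonempty := fun t => by
        obtain ⟨x, hx⟩ := P.net.pre_nonempty t.1
        exact ⟨⟨x, hD.inPlaces t.2 hx⟩, hx⟩
      post_finite := fun t => Set.Finite.preimage (f := Subtype.val)
        Subtype.val_injective.injOn (P.net.post_finite t.1) }
  mapS x := P.mapS x.1
  mapT t := P.mapT t.1
  post_le_one _ _ := P.post_le_one _ _
  post_unique _ _ _ h h' := Subtype.ext (P.post_unique _ _ _ h h')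
  pre_le_one _ _ := P.pre_le_one _ _
  pre_unique _ _ _ h h' := Subtype.ext (P.pre_unique _ _ _ h h')
  init_eq_one x h := by
    rcases x.2 with hx | ⟨t, ht, hx⟩
    · exact hx
    · exact absurd (h ⟨t, ht⟩) hx.ne'
  init_eq_zero x := fun ⟨t, ht⟩ => P.init_eq_zero x.1 ⟨t.1, ht⟩
  acyclic x h := by
    exact P.acyclic _ (h.map (m := P.net) (f := Subtype.val) (g := Subtype.val)
      (fun _ _ h => h) fun _ _ h => h)
  finite_past v := by
    refine Set.Finite.subset ((P.finite_past v.1).preimage Subtype.val_injective.injOn) ?_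
    intro t h
    exact PTNet.FlowPlus.map (m := P.net) (f := Subtype.val) (g := Subtype.val)
      (fun _ _ h => h) (fun _ _ h => h) h
  map_init s := by
    rw [P.map_init]
    exact (Set.encard_subtype_setOf (fun x => P.mapS x = s ∧ P.net.init x = 1)
      fun _ h => Or.inl h.2).symm
  map_pre t s := by
    rw [P.map_pre]
    exact (Set.encard_subtype_setOf (fun x => P.mapS x = s ∧ 0 < P.net.pre t.1 x)
      fun _ h => hD.inPlaces t.2 h.2).symm
  map_post t s := by
    rw [P.map_post]
    exact (Set.encard_subtype_setOf (fun x => P.mapS x = s ∧ 0 < P.net.post t.1 x)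
      fun _ h => Or.inr ⟨_, t.2, h.2⟩).symm

/-- `f` and `g` embed the process `P'` as a prefix into `P`. -/
structure IsEmb (P' P : GRProc N) (f : P'.net.Place → P.net.Place)
    (g : P'.net.Trans → P.net.Trans) : Prop where
  injS : Function.Injective f
  injT : Function.Injective g
  init : ∀ s, P.net.init (f s) = P'.net.init s
  init_zero : ∀ s, s ∉ Set.range f → P.net.init s = 0
  pre : ∀ t s, P.net.pre (g t) (f s) = P'.net.pre t s
  post : ∀ t s, P.net.post (g t) (f s) = P'.net.post t s
  mapS : ∀ s, P.mapS (f s) = P'.mapS s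
  mapT : ∀ t, P.mapT (g t) = P'.mapT t

theorem IsEmb.prefix {P' P : GRProc N} {f : P'.net.Place → P.net.Place}
    {g : P'.net.Trans → P.net.Trans} (h : IsEmb P' P f g) : P'.Prefix P :=
  ⟨f, g, h.injS, h.injT, h.init, h.init_zero, h.pre, h.post, h.mapS, h.mapT⟩

theorem Prefix.exists_isEmb {P' P : GRProc N} (h : P'.Prefix P) : ∃ f g, IsEmb P' P f g := by
  obtain ⟨f, g, h1, h2, h3, h4, h5, h6, h7, h8⟩ := h
  exact ⟨f, g, h1, h2, h3, h4, h5, h6, h7, h8⟩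

theorem IsEmb.comp {P Q R : GRProc N} {f : P.net.Place → Q.net.Place}
    {g : P.net.Trans → Q.net.Trans} {f' : Q.net.Place → R.net.Place}
    {g' : Q.net.Trans → R.net.Trans} (h' : IsEmb Q R f' g') (h : IsEmb P Q f g) :
    IsEmb P R (f' ∘ f) (g' ∘ g) where
  injS := h'.injS.comp h.injS
  injT := h'.injT.comp h.injT
  init s := (h'.init _).trans (h.init _)
  init_zero s hs := by
    by_cases h1 : s ∈ Set.range f'
    · obtain ⟨y, rfl⟩ := h1
      rw [h'.init]
      refine h.init_zero _ ?_
      rintro ⟨x, rfl⟩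
      exact hs ⟨x, rfl⟩
    · exact h'.init_zero _ h1
  pre t s := (h'.pre _ _).trans (h.pre _ _)
  post t s := (h'.post _ _).trans (h.post _ _)
  mapS s := (h'.mapS _).trans (h.mapS _)
  mapT t := (h'.mapT _).trans (h.mapT _)

theorem Prefix.trans {P Q R : GRProc N} (h : P.Prefix Q) (h' : Q.Prefix R) : P.Prefix R := by
  obtain ⟨f, g, h⟩ := h.exists_isEmb
  obtain ⟨f', g', h'⟩ := h'.exists_isEmb
  exact (h'.comp h).prefix

theorem Prefix.refl (P : GRProc N) : P.Prefix P :=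
  IsEmb.prefix (f := id) (g := id) ⟨Function.injective_id, Function.injective_id, fun _ => rfl,
    fun s h => absurd ⟨s, rfl⟩ h, fun _ _ => rfl, fun _ _ => rfl, fun _ => rfl, fun _ => rfl⟩

theorem Iso.prefix {P Q : GRProc N} (h : Iso P Q) : P.Prefix Q := by
  obtain ⟨f, g, h1, h2, h3, h4, h5⟩ := h
  exact IsEmb.prefix (f := f) (g := g) ⟨f.injective, g.injective, h1,
    fun s hs => absurd (f.surjective s) hs, h2, h3, h4, h5⟩

/-- Both presets contain the same finite number of places with each label, prescribed by `N`; an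
injection between them is therefore onto. -/
theorem IsEmb.mem_range_of_pre {P Q : GRProc N} {f : P.net.Place → Q.net.Place}
    {g : P.net.Trans → Q.net.Trans} (h : IsEmb P Q f g) {t : P.net.Trans} {y : Q.net.Place}
    (hy : 0 < Q.net.pre (g t) y) : y ∈ Set.range f := by
  have hsub : f '' {x | P.mapS x = Q.mapS y ∧ 0 < P.net.pre t x} ⊆
      {x | Q.mapS x = Q.mapS y ∧ 0 < Q.net.pre (g t) x} := by
    rintro _ ⟨x, ⟨h1, h2⟩, rfl⟩
    exact ⟨(h.mapS x).trans h1, by rwa [h.pre]⟩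
  have hfin : {x | Q.mapS x = Q.mapS y ∧ 0 < Q.net.pre (g t) x}.Finite := Q.finite_label_pre _ _
  have heq := hfin.eq_of_subset_of_encard_le' hsub (by
    rw [h.injS.encard_image, ← P.map_pre, ← Q.map_pre, h.mapT])
  have : y ∈ {x | Q.mapS x = Q.mapS y ∧ 0 < Q.net.pre (g t) x} := ⟨rfl, hy⟩
  rw [← heq] at this
  obtain ⟨x, -, hx⟩ := this
  exact ⟨x, hx⟩

/-- A place of the prefix is initial, and then has no producer, or already has a producer in the
prefix, and producers are unique. -/
theorem IsEmb.mem_range_of_post {P Q : GRProc N} {f : P.net.Place → Q.net.Place}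
    {g : P.net.Trans → Q.net.Trans} (h : IsEmb P Q f g) {v : Q.net.Trans} {x : P.net.Place}
    (hy : 0 < Q.net.post v (f x)) : v ∈ Set.range g := by
  rcases P.isInit_or x with h1 | ⟨t, h1⟩
  · rw [← h.init, init_eq_one_iff] at h1
    exact absurd (h1 v) hy.ne'
  · rw [← h.post] at h1
    exact ⟨t, Q.post_unique _ _ _ h1 hy⟩

theorem IsEmb.downClosed {P Q : GRProc N} {f : P.net.Place → Q.net.Place}
    {g : P.net.Trans → Q.net.Trans} (h : IsEmb P Q f g) : Q.DownClosed (Set.range g) := by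
  rintro t x _ h1 h2 ⟨v, rfl⟩
  obtain ⟨y, rfl⟩ := h.mem_range_of_pre h2
  exact h.mem_range_of_post h1

theorem restrict_isEmb (P : GRProc N) (D : Set P.net.Trans) (hD : P.DownClosed D) :
    IsEmb (P.restrict D hD) P Subtype.val Subtype.val where
  injS := Subtype.val_injective
  injT := Subtype.val_injective
  init _ := rfl
  init_zero s hs := by
    rcases P.isInit_or s with h | h
    · exact absurd ⟨⟨s, Or.inl h⟩, rfl⟩ hs
    · exact P.init_eq_zero s h
  pre _ _ := rfl
  post _ _ := rfl
  mapS _ := rfl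
  mapT _ := rfl

theorem IsEmb.prefix_restrict {P Q : GRProc N} {f : P.net.Place → Q.net.Place}
    {g : P.net.Trans → Q.net.Trans} (h : IsEmb P Q f g) {D : Set Q.net.Trans}
    (hD : Q.DownClosed D) (hg : Set.range g ⊆ D) : P.Prefix (Q.restrict D hD) := by
  have hf : ∀ x, Q.InPlaces D (f x) := fun x =>
    inPlaces_of_producers fun t ht => hg (h.mem_range_of_post ht)
  refine IsEmb.prefix (f := fun x => ⟨f x, hf x⟩) (g := fun t => ⟨g t, hg ⟨t, rfl⟩⟩)
    ⟨fun a b e => h.injS (congrArg Subtype.val e), fun a b e => h.injT (congrArg Subtype.val e),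
      h.init, fun s hs => h.init_zero s.1 ?_, h.pre, h.post, h.mapS, h.mapT⟩
  rintro ⟨x, hx⟩
  exact hs ⟨x, Subtype.ext hx⟩

theorem restrict_isFinite (P : GRProc N) {D : Set P.net.Trans} (hD : P.DownClosed D)
    (hf : D.Finite) : (P.restrict D hD).IsFinite :=
  hf.to_subtype

/-- Add all causal predecessors; finiteness of pasts keeps the set finite. This supplies the finite
prefixes from which runs are computed. -/
theorem exists_downClosed (P : GRProc N) {E : Set P.net.Trans} (hE : E.Finite) :
    ∃ D : Set P.net.Trans, E ⊆ D ∧ D.Finite ∧ P.DownClosed D := by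
  refine ⟨E ∪ ⋃ v ∈ E, {t | P.net.FlowPlus (Sum.inr t) (Sum.inr v)}, Set.subset_union_left,
    hE.union (hE.biUnion fun v _ => P.finite_past v), ?_⟩
  intro t x v h1 h2 hv
  have h12 : P.net.FlowPlus (Sum.inr t) (Sum.inr v) :=
    Relation.TransGen.tail (b := Sum.inl x) (Relation.TransGen.single h1) h2
  right
  simp only [Set.mem_iUnion]
  rcases hv with hv | hv
  · exact ⟨v, hv, h12⟩
  · simp only [Set.mem_iUnion] at hv
    obtain ⟨w, hw, h3⟩ := hv
    exact ⟨w, hw, Relation.TransGen.trans h12 h3⟩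

/-! ### Compatibility of swaps with restrictions and extensions. -/

open Classical in
/-- Swapping two places and restricting to a set of transitions commute, if the set produces
both places. -/
theorem swapStep_restrict (P : GRProc N) {p q : P.net.Place}
    (hpq : ¬ P.net.FlowPlus (Sum.inl p) (Sum.inl q))
    (hqp : ¬ P.net.FlowPlus (Sum.inl q) (Sum.inl p)) (hl : P.mapS p = P.mapS q)
    {D : Set P.net.Trans} (hD : P.DownClosed D) (hp : P.InPlaces D p) (hq : P.InPlaces D q)
    (hD' : (P.rePre _ (P.isPre_swap hpq hqp hl)).DownClosed D) :
    SwapStep (P.restrict D hD) ((P.rePre _ (P.isPre_swap hpq hqp hl)).restrict D hD') := by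
  have lift : ∀ a b, (P.restrict D hD).net.FlowPlus a b →
      P.net.FlowPlus (Sum.map Subtype.val Subtype.val a) (Sum.map Subtype.val Subtype.val b) := by
    intro a b h
    exact PTNet.FlowPlus.map (m := P.net) (f := Subtype.val) (g := Subtype.val)
      (fun _ _ h => h) (fun _ _ h => h) h
  refine ⟨⟨p, hp⟩, ⟨q, hq⟩, fun h => hpq (lift _ _ h), fun h => hqp (lift _ _ h), hl,
    Equiv.refl _, Equiv.refl _, fun _ => rfl, ?_, fun _ _ => rfl, fun _ => rfl, fun _ => rfl⟩
  intro t s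
  show (P.net.swap p q).pre t.1 s.1 = ((P.restrict D hD).net.swap ⟨p, hp⟩ ⟨q, hq⟩).pre t s
  rw [PTNet.swap_pre]
  refine Eq.trans ?_ (PTNet.swap_pre (P.restrict D hD).net ⟨p, hp⟩ ⟨q, hq⟩ t s).symm
  exact congrArg _ (@Function.Injective.swap_apply _ _ (fun _ _ => propDecidable _) _ _
    Subtype.val_injective (⟨p, hp⟩ : {x // P.InPlaces D x}) ⟨q, hq⟩ s)

/-- Only `p` and `q` get new consumers, and their producers lie in `D` by assumption. -/
theorem downClosed_swap (P : GRProc N) {p q : P.net.Place}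
    (hpq : ¬ P.net.FlowPlus (Sum.inl p) (Sum.inl q))
    (hqp : ¬ P.net.FlowPlus (Sum.inl q) (Sum.inl p)) (hl : P.mapS p = P.mapS q)
    {D : Set P.net.Trans} (hD : P.DownClosed D) (hp : P.InPlaces D p) (hq : P.InPlaces D q) :
    (P.rePre _ (P.isPre_swap hpq hqp hl)).DownClosed D := by
  intro t x v h1 h2 hv
  change 0 < P.net.post t x at h1
  change 0 < (P.net.swap p q).pre v x at h2
  by_cases h3 : x = p
  · exact (h3 ▸ hp).mem h1
  · by_cases h4 : x = q
    · exact (h4 ▸ hq).mem h1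
    · simp only [PTNet.swap, h3, h4, if_false] at h2
      exact hD _ _ _ h1 h2 hv

theorem swapStar_finite {P Q : GRProc N} (h : SwapStar P Q) : P.IsFinite → Q.IsFinite := by
  intro hP
  unfold SwapStar at h
  induction h with
  | refl => exact hP
  | tail _ h ih =>
    rcases h with ⟨_, g, _⟩ | ⟨_, _, _, _, _, _, g, _⟩
    · exact @Finite.of_equiv _ _ ih g
    · exact @Finite.of_equiv _ _ ih g

/-- A prefix is closed backwards along arcs, so a path of `Q` that ends in it can be lifted arc by
arc from its end. Hence places unrelated in the prefix stay unrelated in `Q`. -/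
theorem IsEmb.flowPlus_reflect {P Q : GRProc N} {f : P.net.Place → Q.net.Place}
    {g : P.net.Trans → Q.net.Trans} (h : IsEmb P Q f g) {p q : P.net.Place}
    (hpq : Q.net.FlowPlus (Sum.inl (f p)) (Sum.inl (f q))) :
    P.net.FlowPlus (Sum.inl p) (Sum.inl q) := by
  have key : ∀ a b, Q.net.FlowPlus a b → ∀ b', b = Sum.map f g b' → ∃ a', a = Sum.map f g a' ∧
      P.net.FlowPlus a' b' := by
    have arc : ∀ a b', Q.net.Arc a (Sum.map f g b') → ∃ a', a = Sum.map f g a' ∧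
        P.net.Arc a' b' := by
      rintro (s | t) (s' | t') h1
      · exact h1.elim
      · obtain ⟨x, rfl⟩ := h.mem_range_of_pre h1
        exact ⟨Sum.inl x, rfl, h1.trans_eq (h.pre t' x)⟩
      · obtain ⟨x, rfl⟩ := h.mem_range_of_post h1
        exact ⟨Sum.inr x, rfl, h1.trans_eq (h.post x s')⟩
      · exact h1.elim
    intro a b hab
    unfold PTNet.FlowPlus at hab
    induction hab with
    | single h1 =>
      rintro b' rfl
      obtain ⟨a', h2, h3⟩ := arc _ _ h1
      exact ⟨a', h2, Relation.TransGen.single h3⟩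
    | tail _ h1 ih =>
      rintro b' rfl
      obtain ⟨c', rfl, h3⟩ := arc _ _ h1
      obtain ⟨a', h4, h5⟩ := ih c' rfl
      exact ⟨a', h4, Relation.TransGen.tail h5 h3⟩
  obtain ⟨a', h1, h2⟩ := key _ _ hpq (Sum.inl q) rfl
  rcases a' with a | a
  · rwa [h.injS (Sum.inl_injective h1)]
  · cases h1

open Classical in
/-- A swap of a prefix extends to a swap of the whole process. -/
theorem exists_prefix_of_swapStep {P P' Q : GRProc N} (h : P.Prefix Q) (hs : SwapStep P P') :
    ∃ (p q : Q.net.Place) (hpq : ¬ Q.net.FlowPlus (Sum.inl p) (Sum.inl q))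
      (hqp : ¬ Q.net.FlowPlus (Sum.inl q) (Sum.inl p)) (hl : Q.mapS p = Q.mapS q),
      P'.Prefix (Q.rePre _ (Q.isPre_swap hpq hqp hl)) := by
  obtain ⟨f, g, h⟩ := h.exists_isEmb
  obtain ⟨p, q, hpq, hqp, hl, hiso⟩ := hs
  refine ⟨f p, f q, fun h1 => hpq (h.flowPlus_reflect h1), fun h1 => hqp (h.flowPlus_reflect h1),
    by rw [h.mapS, h.mapS, hl], ?_⟩
  have h1 : Iso (P.rePre _ (P.isPre_swap hpq hqp hl)) P' := hiso
  refine h1.symm.prefix.trans (IsEmb.prefix (f := f) (g := g) ?_)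
  refine ⟨h.injS, h.injT, h.init, h.init_zero, ?_, h.post, h.mapS, h.mapT⟩
  intro (t : P.net.Trans) (s : P.net.Place)
  show (Q.net.swap (f p) (f q)).pre (g t) (f s) = (P.net.swap p q).pre t s
  rw [PTNet.swap_pre, PTNet.swap_pre, h.injS.swap_apply, h.pre]

/-- Swapping a prefix extends to the whole process. -/
theorem exists_prefix_of_swapStar_of {P P' Q : GRProc N} (R : GRProc N → GRProc N → Prop)
    (hR0 : ∀ Q, R Q Q) (hRt : ∀ A B C, R A B → R B C → R A C)
    (hR : ∀ (Q : GRProc N) (p q : Q.net.Place) (hpq : ¬ Q.net.FlowPlus (Sum.inl p) (Sum.inl q))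
      (hqp : ¬ Q.net.FlowPlus (Sum.inl q) (Sum.inl p)) (hl : Q.mapS p = Q.mapS q),
      R Q (Q.rePre _ (Q.isPre_swap hpq hqp hl)))
    (h : P.Prefix Q) (hs : SwapStar P P') :
    ∃ Q', R Q Q' ∧ P'.Prefix Q' := by
  unfold SwapStar at hs
  induction hs with
  | refl => exact ⟨Q, hR0 Q, h⟩
  | tail _ h1 ih =>
    obtain ⟨Q', h2, h3⟩ := ih
    rcases h1 with h1 | h1
    · exact ⟨Q', h2, h1.symm.prefix.trans h3⟩
    · obtain ⟨p, q, hpq, hqp, hl, h4⟩ := exists_prefix_of_swapStep h3 h1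
      exact ⟨_, hRt _ _ _ h2 (hR Q' p q hpq hqp hl), h4⟩

theorem exists_prefix_of_swapStar {P P' Q : GRProc N} (h : P.Prefix Q) (hs : SwapStar P P') :
    ∃ Q', SwapStar Q Q' ∧ P'.Prefix Q' :=
  exists_prefix_of_swapStar_of SwapStar (fun _ => Relation.ReflTransGen.refl)
    (fun _ _ _ => Relation.ReflTransGen.trans)
    (fun Q _ _ hpq hqp hl => Relation.ReflTransGen.single (Or.inr (Q.swapStep_rePre hpq hqp hl)))
    h hs

end GRProc

/-! ### The order on finite classes, and runs of processes. -/

namespace FinBD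

variable {N : PTNet.{u}}

theorem mk_eq_iff {P Q : GRProc N} {hP : P.IsFinite} {hQ : Q.IsFinite} :
    mk P hP = mk Q hQ ↔ GRProc.SwapStar P Q :=
  ⟨fun h => Quotient.exact h, fun h => Quotient.sound (s := finSwapSetoid N) h⟩

theorem Le.of_prefix {P Q : GRProc N} (h : P.Prefix Q) (hP : P.IsFinite) (hQ : Q.IsFinite) :
    Le (mk P hP) (mk Q hQ) :=
  ⟨P, Q, hP, hQ, rfl, h, rfl⟩

/-- The two representatives of `b` are related by swaps, and these swaps can be carried out inside
the representative of `c`. -/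
theorem Le.trans {a b c : FinBD N} (h : Le a b) (h' : Le b c) : Le a c := by
  obtain ⟨A, B, hA, hB, rfl, h, rfl⟩ := h
  obtain ⟨B', C, hB', hC, h1, h', rfl⟩ := h'
  obtain ⟨C', h2, h3⟩ := GRProc.exists_prefix_of_swapStar h' (mk_eq_iff.1 h1.symm)
  exact ⟨A, C', hA, GRProc.swapStar_finite h2 hC, rfl, h.trans h3, mk_eq_iff.2 h2⟩

theorem Le.exists_prefix {P : GRProc N} {hP : P.IsFinite} {b : FinBD N} (h : Le (mk P hP) b) :
    ∃ (Q : GRProc N) (hQ : Q.IsFinite), P.Prefix Q ∧ b = mk Q hQ := by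
  obtain ⟨A, B, hA, hB, h1, h, rfl⟩ := h
  obtain ⟨C, h2, h3⟩ := GRProc.exists_prefix_of_swapStar h (mk_eq_iff.1 h1.symm)
  exact ⟨C, GRProc.swapStar_finite h2 hB, h3, mk_eq_iff.2 h2⟩

end FinBD

namespace GRProc

variable {N : PTNet.{u}}

theorem mem_toRun_of_prefix {A P : GRProc N} (hA : A.IsFinite) (h : A.Prefix P) :
    FinBD.mk A hA ∈ P.toRun :=
  ⟨A, hA, h, FinBD.Le.of_prefix (Prefix.refl A) hA hA⟩

theorem toRun_subset_of {P Q : GRProc N}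
    (h : ∀ A : GRProc N, ∀ hA : A.IsFinite, A.Prefix P → FinBD.mk A hA ∈ Q.toRun) :
    P.toRun ⊆ Q.toRun := by
  rintro a ⟨A, hA, h1, h2⟩
  obtain ⟨B, hB, h3, h4⟩ := h A hA h1
  exact ⟨B, hB, h3, h2.trans h4⟩

/-- Processes that differ only in their presets have the same run if arbitrarily large finite
parts of them are swapping equivalent. -/
theorem toRun_rePre {P : GRProc N} {pr : P.net.Trans → P.net.Place → ℕ} (h : P.IsPre pr)
    (H : ∀ E : Set P.net.Trans, E.Finite → ∃ (D : Set P.net.Trans) (hD : P.DownClosed D)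
      (hD' : (P.rePre pr h).DownClosed D), E ⊆ D ∧ D.Finite ∧
      SwapStar (P.restrict D hD) ((P.rePre pr h).restrict D hD')) :
    P.toRun = (P.rePre pr h).toRun := by
  apply Set.Subset.antisymm
  · refine toRun_subset_of fun A hA hAP => ?_
    obtain ⟨f, g, hfg⟩ := hAP.exists_isEmb
    obtain ⟨D, hD, hD', hED, hf, hs⟩ := H (Set.range g) (@Set.finite_range _ _ g hA)
    refine ⟨_, (P.rePre pr h).restrict_isFinite hD' hf,
      ((P.rePre pr h).restrict_isEmb D hD').prefix, ?_⟩
    rw [← (FinBD.mk_eq_iff (hP := P.restrict_isFinite hD hf)).2 hs]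
    exact FinBD.Le.of_prefix (hfg.prefix_restrict hD hED) _ _
  · refine toRun_subset_of fun A hA hAP => ?_
    obtain ⟨f, g, hfg⟩ := hAP.exists_isEmb
    obtain ⟨D, hD, hD', hED, hf, hs⟩ := H (Set.range g) (@Set.finite_range _ _ g hA)
    refine ⟨_, P.restrict_isFinite hD hf, (P.restrict_isEmb D hD).prefix, ?_⟩
    rw [(FinBD.mk_eq_iff (hQ := (P.rePre pr h).restrict_isFinite hD' hf)).2 hs]
    exact FinBD.Le.of_prefix (hfg.prefix_restrict hD' hED) _ _

theorem finite_producers (P : GRProc N) (p : P.net.Place) : {t | 0 < P.net.post t p}.Finite :=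
  Set.Subsingleton.finite fun _ h _ h' => P.post_unique _ _ _ h h'

theorem toRun_swap (P : GRProc N) {p q : P.net.Place}
    (hpq : ¬ P.net.FlowPlus (Sum.inl p) (Sum.inl q))
    (hqp : ¬ P.net.FlowPlus (Sum.inl q) (Sum.inl p)) (hl : P.mapS p = P.mapS q) :
    P.toRun = (P.rePre _ (P.isPre_swap hpq hqp hl)).toRun := by
  refine toRun_rePre _ fun E hE => ?_
  -- Including the producers of `p` and `q` makes both places present in the finite part, so that
  -- the swap can be made there.
  obtain ⟨D, hED, hf, hD⟩ := P.exists_downClosed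
    (hE.union ((P.finite_producers p).union (P.finite_producers q)))
  have hp : P.InPlaces D p := inPlaces_of_producers fun t ht => hED (Or.inr (Or.inl ht))
  have hq : P.InPlaces D q := inPlaces_of_producers fun t ht => hED (Or.inr (Or.inr ht))
  exact ⟨D, hD, P.downClosed_swap hpq hqp hl hD hp hq, fun _ h => hED (Or.inl h), hf,
    Relation.ReflTransGen.single (Or.inr (P.swapStep_restrict hpq hqp hl hD hp hq _))⟩

/-- A finite process whose class belongs to the run of `P` is a prefix of a process with the
same run. -/
theorem exists_prefix_of_mem_toRun {B P : GRProc N} {hB : B.IsFinite}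
    (h : FinBD.mk B hB ∈ P.toRun) : ∃ P', P'.toRun = P.toRun ∧ B.Prefix P' := by
  obtain ⟨P0, hP0, h1, h2⟩ := h
  obtain ⟨Q, hQ, h3, h4⟩ := h2.exists_prefix
  obtain ⟨P', h5, h6⟩ := exists_prefix_of_swapStar_of (fun P Q => P.toRun = Q.toRun)
    (fun _ => rfl) (fun _ _ _ => Eq.trans) (fun Q _ _ hpq hqp hl => Q.toRun_swap hpq hqp hl) h1
    (FinBD.mk_eq_iff.1 h4)
  exact ⟨P', h5.symm, h3.trans h6⟩

theorem toRun_isBDRun (P : GRProc N) : IsBDRun P.toRun where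
  nonempty := by
    obtain ⟨D, -, hf, hD⟩ := P.exists_downClosed Set.finite_empty
    exact ⟨_, mem_toRun_of_prefix (P.restrict_isFinite hD hf) (P.restrict_isEmb D hD).prefix⟩
  prefix_closed := by
    rintro a b hab ⟨B, hB, h1, h2⟩
    exact ⟨B, hB, h1, hab.trans h2⟩
  directed := by
    rintro a ⟨A, hA, hAP, ha⟩ b ⟨B, hB, hBP, hb⟩
    obtain ⟨f, g, hfg⟩ := hAP.exists_isEmb
    obtain ⟨f', g', hfg'⟩ := hBP.exists_isEmb
    obtain ⟨D, hED, hf, hD⟩ := P.exists_downClosed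
      ((@Set.finite_range _ _ g hA).union (@Set.finite_range _ _ g' hB))
    refine ⟨_, mem_toRun_of_prefix (P.restrict_isFinite hD hf) (P.restrict_isEmb D hD).prefix,
      ha.trans (FinBD.Le.of_prefix (hfg.prefix_restrict hD fun _ h => hED (Or.inl h)) _ _),
      hb.trans (FinBD.Le.of_prefix (hfg'.prefix_restrict hD fun _ h => hED (Or.inr h)) _ _)⟩

/-- No larger run needs to be examined: a run containing every class is trivially maximal. -/
theorem exists_not_mem_toRun {P : GRProc N} (h : ¬ IsMaximalBDRun P.toRun) :
    ∃ (A : GRProc N) (hA : A.IsFinite), FinBD.mk A hA ∉ P.toRun := by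
  by_contra! hc
  have hc : ∀ a, a ∈ P.toRun := fun a => Quotient.inductionOn a fun A => hc A.1 A.2
  exact h ⟨P.toRun_isBDRun, fun R' _ h' => Set.Subset.antisymm (fun a _ => hc a) h'⟩

end GRProc

/-! ### Linearisations, cuts and reachable markings. -/

namespace GRProc

variable {N : PTNet.{u}}

theorem flowPlus_trans (P : GRProc N) {t v : P.net.Trans} {x : P.net.Place}
    (h1 : 0 < P.net.post t x) (h2 : 0 < P.net.pre v x) :
    P.net.FlowPlus (Sum.inr t) (Sum.inr v) :=
  Relation.TransGen.tail (b := Sum.inl x) (Relation.TransGen.single h1) h2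

theorem finite_label_init (P : GRProc N) (s : N.Place) :
    {x | P.mapS x = s ∧ P.net.init x = 1}.Finite :=
  Set.finite_of_encard_eq_coe (P.map_init s).symm

/-- There are countably many initial places, finitely many per label. Any other place is produced by
a transition with a strictly smaller past than its consumer. As a place has at most one consumer,
induction on the size of the past applies. -/
theorem countable_trans (hN : N.IsCountable) (P : GRProc N) : Countable P.net.Trans := by
  have : Countable N.Place := hN.1
  let past : P.net.Trans → Set P.net.Trans := fun v =>
    {t | P.net.FlowPlus (Sum.inr t) (Sum.inr v)}
  have hcons : ∀ s, {t | 0 < P.net.pre t s}.Countable := fun s =>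
    Set.Subsingleton.countable fun _ h _ h' => P.pre_unique _ _ _ h h'
  have hI : {x | P.net.init x = 1}.Countable := by
    have : {x | P.net.init x = 1} = ⋃ s, {x | P.mapS x = s ∧ P.net.init x = 1} := by
      ext x; simp
    rw [this]
    exact Set.countable_iUnion fun s => (P.finite_label_init s).countable
  have key : ∀ n, {t | (past t).ncard < n}.Countable := by
    intro n
    induction n with
    | zero => simp
    | succ n ih =>
      refine ((hI.biUnion fun s _ => hcons s).union (ih.biUnion fun v _ =>
        (P.net.post_finite v).countable.biUnion fun s _ => hcons s)).mono ?_
      intro t ht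
      obtain ⟨s, hs⟩ := P.net.pre_nonempty t
      rcases P.isInit_or s with h | ⟨v, hv⟩
      · left
        simp only [Set.mem_iUnion]
        exact ⟨s, h, hs⟩
      · right
        simp only [Set.mem_iUnion]
        refine ⟨v, ?_, s, hv, hs⟩
        have hlt : (past v).ncard < (past t).ncard := by
          refine Set.ncard_lt_ncard ⟨fun w hw => Relation.TransGen.trans hw
            (P.flowPlus_trans hv hs), fun h => ?_⟩ (P.finite_past t)
          exact P.acyclic _ (h (P.flowPlus_trans hv hs))
        have ht : (past t).ncard < n + 1 := ht
        show (past v).ncard < n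
        omega
  rw [← Set.countable_univ_iff]
  refine (Set.countable_iUnion key).mono fun t _ => ?_
  simp only [Set.mem_iUnion]
  exact ⟨_, Nat.lt_succ_self _⟩

open Classical in
/-- A causally closed finite set of transitions is an initial segment of a linearisation. -/
theorem exists_rank (hN : N.IsCountable) (P : GRProc N) {E : Set P.net.Trans} (hE : E.Finite)
    (hEd : P.DownClosed E) : ∃ (r : P.net.Trans → ℕ) (k : ℕ), Function.Injective r ∧
      P.net.Ranks r ∧ ∀ t, t ∈ E ↔ r t < k := by
  have := P.countable_trans hN
  obtain ⟨e, he⟩ := exists_injective_nat P.net.Trans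
  have hfin : ∀ v, (insert v {t | P.net.FlowPlus (Sum.inr t) (Sum.inr v)}).Finite :=
    fun v => (P.finite_past v).insert v
  let S : P.net.Trans → Finset ℕ := fun v => (hfin v).toFinset.image e
  have hS : ∀ t v, e t ∈ S v ↔ (t = v ∨ P.net.FlowPlus (Sum.inr t) (Sum.inr v)) := by
    intro t v
    simp only [S, Finset.mem_image, he.eq_iff, exists_eq_right, Set.Finite.mem_toFinset]
    rfl
  -- The past of `v`, including `v` itself, is encoded in binary. Distinct transitions have distinct
  -- such pasts by acyclicity, and a strictly larger past has a larger code.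
  let ρ : P.net.Trans → ℕ := fun v => ∑ i ∈ S v, 2 ^ i
  have hρi : Function.Injective ρ := by
    intro t v h
    have h : S t = S v := Finset.geomSum_injective le_rfl h
    by_contra hne
    have h1 : e t ∈ S v := h ▸ (hS t t).2 (Or.inl rfl)
    have h2 : e v ∈ S t := h ▸ (hS v v).2 (Or.inl rfl)
    have h1 := ((hS _ _).1 h1).resolve_left hne
    have h2 := ((hS _ _).1 h2).resolve_left (Ne.symm hne)
    exact P.acyclic _ (Relation.TransGen.trans h1 h2)
  have hρ : P.net.Ranks ρ := by
    intro t x v h1 h2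
    have h12 := P.flowPlus_trans h1 h2
    refine Finset.sum_lt_sum_of_subset (i := e v) ?_ ((hS _ _).2 (Or.inl rfl)) ?_ (by positivity)
      fun _ _ _ => Nat.zero_le _
    · intro i hi
      obtain ⟨w, -, rfl⟩ := Finset.mem_image.1 hi
      rw [hS] at hi ⊢
      rcases hi with rfl | hi
      · exact Or.inr h12
      · exact Or.inr (Relation.TransGen.trans hi h12)
    · rw [hS]
      rintro (rfl | h)
      · exact P.acyclic _ h12
      · exact P.acyclic _ (Relation.TransGen.trans h h12)
  let K := hE.toFinset.sup ρ + 1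
  have hK : ∀ t ∈ E, ρ t < K := fun t ht =>
    Nat.lt_succ_of_le (Finset.le_sup (hE.mem_toFinset.2 ht))
  -- Shifting the ranks outside `E` beyond all those in `E` is harmless, because nothing outside `E`
  -- precedes an element of `E`.
  refine ⟨fun t => if t ∈ E then ρ t else K + ρ t, K, ?_, ?_, ?_⟩
  · intro t v h
    have ht := hK t
    have hv := hK v
    apply hρi
    simp only at h
    split_ifs at h with h1 h2 h2
    · exact h
    · have := ht h1; omega
    · have := hv h2; omega
    · omega
  · intro t x v h1 h2
    have h12 := hρ _ _ _ h1 h2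
    have ht := hK t
    simp only
    split_ifs with h3 h4 h4
    · exact h12
    · have := ht h3; omega
    · exact absurd (hEd _ _ _ h1 h2 h4) h3
    · omega
  · intro t
    have ht := hK t
    simp only
    split_ifs with h1
    · exact ⟨fun _ => ht h1, fun _ => h1⟩
    · simp [h1]

/-- The places marked after the transitions of rank less than `i` have fired. -/
def cut (P : GRProc N) (r : P.net.Trans → ℕ) (i : ℕ) : Set P.net.Place :=
  {x | P.InPlaces {t | r t < i} x ∧ ∀ v, 0 < P.net.pre v x → i ≤ r v}

theorem downClosed_lt {P : GRProc N} {r : P.net.Trans → ℕ} (hr : P.net.Ranks r) (i : ℕ) :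
    P.DownClosed {t | r t < i} :=
  fun _ _ _ h1 h2 (hv : r _ < i) => (hr _ _ _ h1 h2).trans hv

theorem mem_cut_of_pre {P : GRProc N} {r : P.net.Trans → ℕ} (hr : P.net.Ranks r)
    {v : P.net.Trans} {x : P.net.Place} (h : 0 < P.net.pre v x) : x ∈ P.cut r (r v) :=
  ⟨inPlaces_of_producers fun _ ht => hr _ _ _ ht h, fun _ hw => P.pre_unique _ _ _ h hw ▸ le_rfl⟩

end GRProc

theorem PTNet.canFire_iff (N : PTNet.{u}) (M : N.Place → ℕ) (G : Multiset N.Trans) :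
    N.CanFire M G ↔ G ≠ 0 ∧ ∀ s, N.preM G s ≤ M s :=
  ⟨fun ⟨_, h⟩ => ⟨h.1, h.2.1⟩, fun h => ⟨_, h.1, h.2, fun _ => rfl⟩⟩

theorem Set.encard_diff_eq_coe_sub {α : Type*} {A B : Set α} (h : B ⊆ A) {a b : ℕ}
    (hA : (a : ℕ∞) = A.encard) (hB : (b : ℕ∞) = B.encard) :
    b ≤ a ∧ (A \ B).encard = ((a - b : ℕ) : ℕ∞) := by
  have h1 := Set.encard_sdiff_add_encard_of_subset h
  rw [← hA, ← hB] at h1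
  have h2 : (A \ B).encard ≠ ⊤ := by
    intro h2
    rw [h2, top_add] at h1
    exact ENat.top_ne_natCast _ h1
  obtain ⟨c, hc⟩ := ENat.ne_top_iff_exists.1 h2
  rw [← hc] at h1 ⊢
  norm_cast at h1 ⊢
  omega

namespace GRProc

variable {N : PTNet.{u}}

/-- Cuts represent reachable markings. -/
theorem exists_reachable {P : GRProc N} {r : P.net.Trans → ℕ} (hr : P.net.Ranks r)
    (hinj : Function.Injective r) (i : ℕ) : ∃ M, N.Reachable M ∧
      ∀ s, (M s : ℕ∞) = {x | P.mapS x = s ∧ x ∈ P.cut r i}.encard := by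
  induction i with
  | zero =>
    refine ⟨N.init, Relation.ReflTransGen.refl, fun s => ?_⟩
    rw [P.map_init]
    congr 1
    ext x
    refine and_congr_right fun _ => ⟨fun h => ⟨Or.inl h, fun v _ => Nat.zero_le _⟩, ?_⟩
    rintro ⟨h | ⟨t, ht, -⟩, -⟩
    · exact h
    · exact absurd ht (Nat.not_lt_zero _)
  | succ i ih =>
    obtain ⟨M, hM, hMs⟩ := ih
    by_cases hu : ∃ v, r v = i
    · obtain ⟨v, rfl⟩ := hu
      have hpre : ∀ s, {x | P.mapS x = s ∧ 0 < P.net.pre v x} ⊆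
          {x | P.mapS x = s ∧ x ∈ P.cut r (r v)} :=
        fun s x hx => ⟨hx.1, mem_cut_of_pre hr hx.2⟩
      have hd := fun s => Set.encard_diff_eq_coe_sub (hpre s) (hMs s) (P.map_pre v s)
      refine ⟨fun s => M s - N.pre (P.mapT v) s + N.post (P.mapT v) s,
        Relation.ReflTransGen.tail hM ⟨P.mapT v, by simp, fun s => ?_, fun s => ?_⟩, fun s => ?_⟩
      · simpa [PTNet.preM] using (hd s).1
      · simp [PTNet.preM, PTNet.postM]
      · rw [Nat.cast_add, ← (hd s).2, P.map_post, ← Set.encard_union_eq]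
        · congr 1
          ext x
          constructor
          · rintro (⟨⟨h1, h2, h3⟩, h4⟩ | ⟨h1, h2⟩)
            · refine ⟨h1, h2.mono fun t (ht : r t < r v) => Nat.lt_succ_of_lt ht, fun w hw => ?_⟩
              refine Nat.succ_le_of_lt (lt_of_le_of_ne (h3 w hw) fun e => h4 ⟨h1, ?_⟩)
              rwa [hinj e]
            · exact ⟨h1, Or.inr ⟨v, Nat.lt_succ_self _, h2⟩, fun w hw => hr _ _ _ h2 hw⟩
          · rintro ⟨h1, h2, h3⟩
            by_cases h4 : 0 < P.net.post v x
            · exact Or.inr ⟨h1, h4⟩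
            · refine Or.inl ⟨⟨h1, inPlaces_of_producers fun t ht => ?_,
                fun w hw => (Nat.le_succ _).trans (h3 w hw)⟩, fun h5 => ?_⟩
              · refine lt_of_le_of_ne (Nat.lt_succ_iff.1 (h2.mem ht)) fun e => h4 ?_
                rwa [← hinj e]
              · exact absurd (h3 v h5.2) (by omega)
        · rw [Set.disjoint_left]
          rintro x ⟨⟨-, h1, -⟩, -⟩ ⟨-, h2⟩
          exact lt_irrefl (r v) (h1.mem h2)
    -- Ranks may have gaps; at a gap the cut, and hence the marking, stays the same.
    · refine ⟨M, hM, fun s => (hMs s).trans ?_⟩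
      have e : {t | r t < i + 1} = {t | r t < i} := by
        ext t
        have : r t ≠ i := fun h => hu ⟨t, h⟩
        simp only [Set.mem_ofPred_eq]
        omega
      congr 1
      ext x
      simp only [cut, e, Set.mem_ofPred_eq]
      refine and_congr_right fun _ => and_congr_right fun _ => forall₂_congr fun v _ => ?_
      have : r v ≠ i := fun h => hu ⟨v, h⟩
      omega

/-- A path would lead from a consumer of `p`, of rank at least `i`, to a producer of `q`, of rank
below `i`. Thus equally labelled places of a cut may always be swapped. -/
theorem not_flowPlus_of_mem_cut {P : GRProc N} {r : P.net.Trans → ℕ} (hr : P.net.Ranks r) {i : ℕ}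
    {p q : P.net.Place} (hp : p ∈ P.cut r i) (hq : q ∈ P.cut r i) :
    ¬ P.net.FlowPlus (Sum.inl p) (Sum.inl q) := by
  intro h
  obtain ⟨v, w, h1, h2, h3⟩ := hr.rel h
  have h4 := hp.2 v h1
  have h5 : r w < i := hq.1.mem h2
  omega

open Classical in
/-- By finitely many swaps in a cut, the next transition can be made to consume any set of places
of the cut that has the right labels. -/
theorem exists_retarget (n : ℕ) : ∀ (P : GRProc N) (r : P.net.Trans → ℕ) (_ : P.net.Ranks r)
    (v : P.net.Trans) (W : Set P.net.Place) (_ : W ⊆ P.cut r (r v))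
    (_ : ∀ s, (N.pre (P.mapT v) s : ℕ∞) = {x | P.mapS x = s ∧ x ∈ W}.encard)
    (_ : {x | 0 < P.net.pre v x ∧ x ∉ W}.ncard = n),
    ∃ (pr : P.net.Trans → P.net.Place → ℕ) (h : P.IsPre pr), (P.rePre pr h).net.Ranks r ∧
      (∀ w, r w < r v → pr w = P.net.pre w) ∧ (∀ x, 0 < pr v x ↔ x ∈ W) ∧
      ∀ m, r v ≤ m → ∀ (hD : P.DownClosed {t | r t < m})
        (hD' : (P.rePre pr h).DownClosed {t | r t < m}),
        SwapStar (P.restrict _ hD) ((P.rePre pr h).restrict _ hD') := by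
  induction n with
  | zero =>
    intro P r hr v W hW hWc hn
    have hsub : ∀ x, 0 < P.net.pre v x → x ∈ W := by
      rw [Set.ncard_eq_zero ((P.net.pre_finite v).subset fun _ h => h.1)] at hn
      intro x hx
      by_contra hxW
      exact (Set.ext_iff.1 hn x).1 ⟨hx, hxW⟩
    refine ⟨P.net.pre, P.isPre_self, hr, fun _ _ => rfl, fun x => ⟨hsub x, fun hx => ?_⟩,
      fun m _ hD hD' => Relation.ReflTransGen.refl⟩
    have hfin : {y | P.mapS y = P.mapS x ∧ y ∈ W}.Finite :=
      Set.finite_of_encard_eq_coe (hWc _).symm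
    have heq := hfin.eq_of_subset_of_encard_le'
      (show {y | P.mapS y = P.mapS x ∧ 0 < P.net.pre v y} ⊆ _ from
        fun y hy => ⟨hy.1, hsub y hy.2⟩) (by rw [← hWc, P.map_pre])
    exact ((Set.ext_iff.1 heq x).2 ⟨rfl, hx⟩).2
  | succ n ih =>
    intro P r hr v W hW hWc hn
    obtain ⟨p, hp, hpW⟩ := Set.nonempty_of_ncard_ne_zero (hn.trans_ne n.succ_ne_zero)
    -- `W` and the preset of `v` have equally many places with the label of `p`, and `p` is only in
    -- the latter. So `W` has such a place that `v` does not consume.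
    have hq : ∃ q, P.mapS q = P.mapS p ∧ q ∈ W ∧ P.net.pre v q = 0 := by
      by_contra! hc
      have hsub : {y | P.mapS y = P.mapS p ∧ y ∈ W} ⊆
          {y | P.mapS y = P.mapS p ∧ 0 < P.net.pre v y} :=
        fun y hy => ⟨hy.1, Nat.pos_of_ne_zero (hc y hy.1 hy.2)⟩
      have heq := (P.finite_label_pre v (P.mapS p)).eq_of_subset_of_encard_le' hsub
        (by rw [← hWc, P.map_pre])
      exact hpW ((Set.ext_iff.1 heq p).2 ⟨rfl, hp⟩).2
    obtain ⟨q, hql, hqW, hq0⟩ := hq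
    have hpc : p ∈ P.cut r (r v) := mem_cut_of_pre hr hp
    have hqc : q ∈ P.cut r (r v) := hW hqW
    have hpq := not_flowPlus_of_mem_cut hr hpc hqc
    have hqp := not_flowPlus_of_mem_cut hr hqc hpc
    have hσ : ∀ x, x ∈ P.cut r (r v) → Equiv.swap p q x ∈ P.cut r (r v) := by
      intro x hx
      rw [Equiv.swap_apply_def]
      split_ifs
      exacts [hqc, hpc, hx]
    -- The swap moves only places of the cut, which are produced before rank `r v` and consumed no
    -- earlier. Hence `r` remains a ranking and earlier presets do not change.
    have hor : ∀ x, (x ∈ P.cut r (r v) ∧ Equiv.swap p q x ∈ P.cut r (r v)) ∨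
        Equiv.swap p q x = x := by
      intro x
      by_cases h : x ∈ P.cut r (r v)
      · exact Or.inl ⟨h, hσ x h⟩
      · exact Or.inr (Equiv.swap_apply_of_ne_of_ne (fun e => h (e ▸ hpc)) fun e => h (e ▸ hqc))
    let P1 := P.rePre _ (P.isPre_swap hpq hqp hql.symm)
    have hpre : ∀ t x, P1.net.pre t x = P.net.pre t (Equiv.swap p q x) :=
      fun t x => PTNet.swap_pre P.net p q t x
    have hr1 : P1.net.Ranks r := by
      intro t x w h1 h2
      rw [hpre] at h2
      rcases hor x with ⟨h3, h4⟩ | h3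
      · exact (show r t < r v from h3.1.mem h1).trans_le (h4.2 _ h2)
      · exact hr _ _ _ h1 (h3 ▸ h2)
    have hW1 : W ⊆ P1.cut r (r v) := fun x hx => ⟨(hW hx).1, fun w hw => by
      rw [hpre] at hw
      exact (hσ _ (hW hx)).2 w hw⟩
    -- After the swap `v` consumes `q` in `W` instead of `p`, so one misplaced preplace fewer
    -- remains.
    have hn1 : {x | 0 < P1.net.pre v x ∧ x ∉ W}.ncard = n := by
      have : {x | 0 < P1.net.pre v x ∧ x ∉ W} = {x | 0 < P.net.pre v x ∧ x ∉ W} \ {p} := by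
        ext (x : P.net.Place)
        show (0 < P1.net.pre v x ∧ x ∉ W) ↔ (0 < P.net.pre v x ∧ x ∉ W) ∧ x ≠ p
        rw [hpre]
        by_cases h1 : x = p
        · simp [h1, hq0]
        · by_cases h2 : x = q
          · simp [h2, hqW]
          · simp [Equiv.swap_apply_of_ne_of_ne h1 h2, h1]
      rw [this]
      refine (Set.ncard_sdiff_singleton_of_mem (show p ∈ {x | 0 < P.net.pre v x ∧ x ∉ W} from
        ⟨hp, hpW⟩)).trans ?_
      rw [hn]
      rfl
    obtain ⟨pr, h, g1, g2, g3, g4⟩ := ih P1 r hr1 v W hW1 hWc hn1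
    refine ⟨pr, ⟨h.fin, h.ne, h.le_one, h.unique, h.acyclic, h.finite_past, h.map_pre⟩, g1,
      fun w hw => (g2 w hw).trans (funext fun x => ?_), g3, fun m hm hD hD' => ?_⟩
    · rw [hpre]
      rcases hor x with ⟨h3, h4⟩ | h3
      · have h5 : ¬ 0 < P.net.pre w x := fun h => (h3.2 w h).not_gt hw
        have h6 : ¬ 0 < P.net.pre w (Equiv.swap p q x) := fun h => (h4.2 w h).not_gt hw
        omega
      · rw [h3]
    · have hmono : {t | r t < r v} ⊆ {t | r t < m} := fun t (ht : r t < r v) => ht.trans_le hm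
      have hp1 := hpc.1.mono hmono
      have hq1 := hqc.1.mono hmono
      exact Relation.ReflTransGen.head (Or.inr (P.swapStep_restrict hpq hqp hql.symm hD hp1 hq1
        (P.downClosed_swap hpq hqp hql.symm hD hp1 hq1))) (g4 m hm _ hD')

end GRProc

/-! ### Adding a transition to a process. -/

theorem exists_labelled_equiv {α β L : Type*} (f : α → L) (g : β → L)
    (hf : ∀ l, {a | f a = l}.Finite) (h : ∀ l, {a | f a = l}.encard = {b | g b = l}.encard) :
    ∃ e : α ≃ β, ∀ a, g (e a) = f a := by
  have key : ∀ l, Nonempty ({a // f a = l} ≃ {b // g b = l}) := fun l => by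
    have h1 : Finite {a // f a = l} := (hf l).to_subtype
    have h2 : Finite {b // g b = l} := (Set.encard_lt_top_iff.1
      ((h l) ▸ Set.encard_lt_top_iff.2 (hf l) : {b | g b = l}.encard < ⊤)).to_subtype
    have h3 : {a | f a = l}.ncard = {b | g b = l}.ncard := congrArg ENat.toNat (h l)
    exact Finite.card_eq.1 h3
  exact ⟨Equiv.ofFiberEquiv fun l => (key l).some, Equiv.ofFiberEquiv_map _⟩

namespace GRProc

variable {N : PTNet.{u}}

/-- Two sets of places with the same finite numbers of labels are in label preserving bijection. -/
theorem exists_placeEquiv {P Q : GRProc N} (p : P.net.Place → Prop) (q : Q.net.Place → Prop)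
    (m : N.Place → ℕ) (hp : ∀ s, (m s : ℕ∞) = {x | P.mapS x = s ∧ p x}.encard)
    (hq : ∀ s, (m s : ℕ∞) = {x | Q.mapS x = s ∧ q x}.encard) :
    ∃ e : {x // p x} ≃ {x // q x}, ∀ x, Q.mapS (e x).1 = P.mapS x.1 := by
  have h1 : ∀ s, {x : {x // p x} | P.mapS x.1 = s}.encard = m s := fun s => by
    rw [hp, ← Set.encard_subtype_setOf (S := p) (fun x => P.mapS x = s ∧ p x) fun _ h => h.2]
    congr 1
    ext x
    exact ⟨fun h => ⟨h, x.2⟩, fun h => h.1⟩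
  have h2 : ∀ s, {x : {x // q x} | Q.mapS x.1 = s}.encard = m s := fun s => by
    rw [hq, ← Set.encard_subtype_setOf (S := q) (fun x => Q.mapS x = s ∧ q x) fun _ h => h.2]
    congr 1
    ext x
    exact ⟨fun h => ⟨h, x.2⟩, fun h => h.1⟩
  exact exists_labelled_equiv (fun x : {x // p x} => P.mapS x.1) (fun x : {x // q x} => Q.mapS x.1)
    (fun s => Set.finite_of_encard_eq_coe (h1 s)) fun s => (h1 s).trans (h2 s).symm

/-- All places of `A` are initial, and the numbers of initial places per label are those of `N.init`
in both processes. -/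
theorem prefix_of_isEmpty {A : GRProc N} [IsEmpty A.net.Trans] (P : GRProc N) : A.Prefix P := by
  have hA : ∀ x, A.net.init x = 1 := fun x => A.init_eq_one x fun t => isEmptyElim t
  obtain ⟨e, he⟩ := exists_placeEquiv (P := A) (Q := P) (fun x => A.net.init x = 1)
    (fun x => P.net.init x = 1) N.init A.map_init P.map_init
  refine IsEmb.prefix (f := fun x => (e ⟨x, hA x⟩).1) (g := fun t => isEmptyElim t)
    ⟨fun x y h => ?_, fun t => isEmptyElim t, fun x => ?_, fun y hy => ?_, fun t => isEmptyElim t,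
      fun t => isEmptyElim t, fun x => he _, fun t => isEmptyElim t⟩
  · exact congrArg Subtype.val (e.injective (Subtype.ext h))
  · rw [(e ⟨x, hA x⟩).2, hA]
  · rcases P.isInit_or y with h | h
    · exact absurd ⟨(e.symm ⟨y, h⟩).1, by simp⟩ hy
    · exact P.init_eq_zero y h

/-- Take a transition with the largest past: one consuming from its postset would have a larger past
still. -/
theorem exists_maximal_trans {A : GRProc N} (hA : A.IsFinite) [Nonempty A.net.Trans] :
    ∃ t : A.net.Trans, ∀ v x, 0 < A.net.post t x → A.net.pre v x = 0 := by
  have : Finite A.net.Trans := hA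
  obtain ⟨t, ht⟩ := Finite.exists_max fun t : A.net.Trans =>
    {v : A.net.Trans | A.net.FlowPlus (Sum.inr v) (Sum.inr t)}.ncard
  refine ⟨t, fun v x h1 => ?_⟩
  by_contra h2
  have h12 := A.flowPlus_trans h1 (Nat.pos_of_ne_zero h2)
  refine (ht v).not_gt (Set.ncard_lt_ncard ⟨fun w hw => Relation.TransGen.trans hw h12,
    fun h => ?_⟩ (A.finite_past v))
  exact A.acyclic _ (h h12)

theorem downClosed_compl {A : GRProc N} {t : A.net.Trans}
    (ht : ∀ v x, 0 < A.net.post t x → A.net.pre v x = 0) : A.DownClosed {t}ᶜ := by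
  rintro w x v h1 h2 - rfl
  exact h2.ne' (ht v x h1)

theorem inPlaces_compl_iff {A : GRProc N} {t : A.net.Trans} {x : A.net.Place} :
    A.InPlaces {t}ᶜ x ↔ ¬ 0 < A.net.post t x :=
  ⟨fun h h' => h.mem h' rfl, fun h => inPlaces_of_producers fun _ hv e => h (e ▸ hv)⟩

theorem pre_eq_of_pos_iff {P Q : GRProc N} {t : P.net.Trans} {v : Q.net.Trans} {x : P.net.Place}
    {y : Q.net.Place} (h : 0 < P.net.pre t x ↔ 0 < Q.net.pre v y) :
    P.net.pre t x = Q.net.pre v y := by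
  have := P.pre_le_one x t
  have := Q.pre_le_one y v
  omega

open Classical in
/-- If `A` without its maximal transition `t` is a prefix of `Q`, and some transition of `Q`
outside of this prefix corresponds to `t`, then `A` is a prefix of `Q`. -/
theorem prefix_of_restrict {A Q : GRProc N} {t : A.net.Trans}
    (ht : ∀ v x, 0 < A.net.post t x → A.net.pre v x = 0)
    {f : (A.restrict _ (downClosed_compl ht)).net.Place → Q.net.Place}
    {g : (A.restrict _ (downClosed_compl ht)).net.Trans → Q.net.Trans}
    (h : IsEmb (A.restrict _ (downClosed_compl ht)) Q f g) {v : Q.net.Trans}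
    (hv : v ∉ Set.range g) (hl : Q.mapT v = A.mapT t)
    (hpre : ∀ x, Q.net.pre v (f x) = A.net.pre t x.1) : A.Prefix Q := by
  obtain ⟨e, he⟩ := exists_placeEquiv (P := A) (Q := Q) (fun x => 0 < A.net.post t x)
    (fun x => 0 < Q.net.post v x) (N.post (A.mapT t)) (A.map_post t)
    (fun s => by rw [← hl]; exact Q.map_post v s)
  -- Places of the prefix are produced only inside it, so the postplaces of `v` are new and `e` can
  -- be glued to `f`.
  have hvf : ∀ x, Q.net.post v (f x) = 0 := fun x => by
    by_contra h1
    exact hv (h.mem_range_of_post (Nat.pos_of_ne_zero h1))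
  have hef : ∀ x y, (e x).1 ≠ f y := fun x y h1 => (e x).2.ne' (h1 ▸ hvf y)
  let F : A.net.Place → Q.net.Place := fun x =>
    if hx : 0 < A.net.post t x then (e ⟨x, hx⟩).1 else f ⟨x, inPlaces_compl_iff.2 hx⟩
  let G : A.net.Trans → Q.net.Trans := fun w => if hw : w = t then v else g ⟨w, hw⟩
  have hF1 : ∀ x (hx : 0 < A.net.post t x), F x = (e ⟨x, hx⟩).1 := fun x hx => dif_pos hx
  have hF2 : ∀ x (hx : ¬ 0 < A.net.post t x), F x = f ⟨x, inPlaces_compl_iff.2 hx⟩ :=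
    fun x hx => dif_neg hx
  have hG1 : G t = v := dif_pos rfl
  have hG2 : ∀ w (hw : w ≠ t), G w = g ⟨w, hw⟩ := fun w hw => dif_neg hw
  refine IsEmb.prefix (f := F) (g := G) ⟨?_, ?_, ?_, ?_, ?_, ?_, ?_, ?_⟩
  · intro x y hxy
    by_cases hx : 0 < A.net.post t x <;> by_cases hy : 0 < A.net.post t y
    · rw [hF1 x hx, hF1 y hy] at hxy
      exact congrArg Subtype.val (e.injective (Subtype.ext hxy))
    · rw [hF1 x hx, hF2 y hy] at hxy
      exact absurd hxy (hef _ _)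
    · rw [hF2 x hx, hF1 y hy] at hxy
      exact absurd hxy.symm (hef _ _)
    · rw [hF2 x hx, hF2 y hy] at hxy
      exact congrArg Subtype.val (h.injS hxy)
  · intro x y hxy
    by_cases hx : x = t <;> by_cases hy : y = t
    · rw [hx, hy]
    · rw [hx, hG1, hG2 y hy] at hxy
      exact absurd ⟨_, hxy.symm⟩ hv
    · rw [hy, hG1, hG2 x hx] at hxy
      exact absurd ⟨_, hxy⟩ hv
    · rw [hG2 x hx, hG2 y hy] at hxy
      exact congrArg Subtype.val (h.injT hxy)
  · intro x
    by_cases hx : 0 < A.net.post t x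
    · rw [hF1 x hx, A.init_eq_zero x ⟨t, hx⟩, Q.init_eq_zero _ ⟨v, (e ⟨x, hx⟩).2⟩]
    · rw [hF2 x hx, h.init]
  · intro y hy
    refine h.init_zero y ?_
    rintro ⟨x, rfl⟩
    exact hy ⟨x.1, hF2 _ (inPlaces_compl_iff.1 x.2)⟩
  · intro w x
    by_cases hx : 0 < A.net.post t x
    · rw [hF1 x hx, ht w x hx]
      by_contra h1
      by_cases hw : w = t
      · rw [hw, hG1] at h1
        exact Q.acyclic _ (Q.flowPlus_trans (e ⟨x, hx⟩).2 (Nat.pos_of_ne_zero h1))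
      · rw [hG2 w hw] at h1
        obtain ⟨y, hy⟩ := h.mem_range_of_pre (Nat.pos_of_ne_zero h1)
        exact hef _ _ hy.symm
    · rw [hF2 x hx]
      by_cases hw : w = t
      · rw [hw, hG1, hpre]
      · rw [hG2 w hw, h.pre]
  · intro w x
    by_cases hx : 0 < A.net.post t x
    · rw [hF1 x hx]
      have h1 := (e ⟨x, hx⟩).2
      by_cases hw : w = t
      · rw [hw, hG1]
        have := A.post_le_one x t
        have := Q.post_le_one (e ⟨x, hx⟩).1 v
        omega
      · rw [hG2 w hw]
        have h2 : ¬ 0 < A.net.post w x := fun h2 => hw (A.post_unique _ _ _ h2 hx)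
        have h3 : ¬ 0 < Q.net.post (g ⟨w, hw⟩) (e ⟨x, hx⟩).1 := fun h3 =>
          hv ⟨_, Q.post_unique _ _ _ h3 h1⟩
        omega
    · rw [hF2 x hx]
      by_cases hw : w = t
      · rw [hw, hG1, hvf]
        omega
      · rw [hG2 w hw, h.post]
  · intro x
    by_cases hx : 0 < A.net.post t x
    · rw [hF1 x hx, he]
    · rw [hF2 x hx, h.mapS]
  · intro w
    by_cases hw : w = t
    · rw [hw, hG1, hl]
    · rw [hG2 w hw, h.mapT]

open Classical in
/-- The net `n` with an additional transition that consumes the places in `X` and produces new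
places indexed by `I`. -/
noncomputable abbrev _root_.PTNet.extend (n : PTNet.{u}) (X : Set n.Place) (hX : X.Finite)
    (hX' : X.Nonempty) (I : Type u) [Finite I] : PTNet.{u} where
  Place := n.Place ⊕ I
  Trans := Option n.Trans
  pre := fun t => Sum.elim (t.elim (fun x => if x ∈ X then 1 else 0) n.pre) fun _ => 0
  post := fun t => Sum.elim (t.elim (fun _ => 0) n.post) fun _ => t.elim 1 fun _ => 0
  init := Sum.elim n.init fun _ => 0
  pre_finite := by
    rintro (_ | t)
    · refine (hX.image Sum.inl).subset ?_
      rintro (x | x) hx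
      · refine ⟨x, ?_, rfl⟩
        by_contra h
        simp [h] at hx
      · simp at hx
    · refine ((n.pre_finite t).image Sum.inl).subset ?_
      rintro (x | x) hx
      · exact ⟨x, hx, rfl⟩
      · simp at hx
  pre_nonempty := by
    rintro (_ | t)
    · obtain ⟨x, hx⟩ := hX'
      exact ⟨Sum.inl x, by simp [hx]⟩
    · obtain ⟨x, hx⟩ := n.pre_nonempty t
      exact ⟨Sum.inl x, hx⟩
  post_finite := by
    rintro (_ | t)
    · refine (Set.finite_range Sum.inr).subset ?_
      rintro (x | x) hx
      · simp at hx
      · exact ⟨x, rfl⟩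
    · refine ((n.post_finite t).image Sum.inl).subset ?_
      rintro (x | x) hx
      · exact ⟨x, hx, rfl⟩
      · simp at hx

instance (t : N.Trans) : Finite (Σ s, Fin (N.post t s)) := by
  have : Finite {s // 0 < N.post t s} := (N.post_finite t).to_subtype
  refine Finite.of_injective (β := Σ s : {s // 0 < N.post t s}, Fin (N.post t s))
    (fun x => ⟨⟨x.1, x.2.pos⟩, x.2⟩) ?_
  rintro ⟨s, i⟩ ⟨s', i'⟩ h
  simp only [Sigma.mk.injEq, Subtype.mk.injEq] at h
  obtain ⟨rfl, h⟩ := h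
  rw [eq_of_heq h]

/-- If the places in `X` are not consumed in `P`, then `P` can be extended by a transition that
consumes them. -/
theorem exists_extension (P : GRProc N) {r : P.net.Trans → ℕ} (hr : P.net.Ranks r)
    (hinj : Function.Injective r) {k : ℕ} {X : Set P.net.Place} (hX : X.Finite) (hX' : X.Nonempty)
    (hXk : ∀ x ∈ X, P.InPlaces {t | r t < k} x) (hXpre : ∀ x ∈ X, ∀ t, P.net.pre t x = 0)
    {τ : N.Trans} (hτ : ∀ s, (N.pre τ s : ℕ∞) = {x | P.mapS x = s ∧ x ∈ X}.encard) :
    ∃ (Q : GRProc N) (f : P.net.Place → Q.net.Place) (g : P.net.Trans → Q.net.Trans)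
      (v : Q.net.Trans), IsEmb P Q f g ∧ v ∉ Set.range g ∧ Q.mapT v = τ ∧
        ∀ x, 0 < Q.net.pre v (f x) ↔ x ∈ X := by
  classical
  let n := P.net.extend X hX hX' (Σ s, Fin (N.post τ s))
  -- The new transition may share the rank `k` with an old one. All that is needed is growth along
  -- the flow, where the producers of `X` have rank below `k`, and finitely many transitions below
  -- each rank.
  let R : n.Trans → ℕ := fun t => Option.elim t k r
  have hR : n.Ranks R := by
    rintro (_ | t) (x | x) (_ | v) h1 h2
    · exact absurd h1 (lt_irrefl 0)
    · exact absurd h1 (lt_irrefl 0)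
    · exact absurd h2 (lt_irrefl 0)
    · exact absurd h2 (lt_irrefl 0)
    · have hx : x ∈ X := by
        by_contra h
        simp [n, h] at h2
      exact (hXk x hx).mem h1
    · exact hr _ _ _ h1 h2
    · exact absurd h2 (lt_irrefl 0)
    · exact absurd h2 (lt_irrefl 0)
  have hRf : ∀ i, {t | R t < i}.Finite := fun i => by
    refine ((Set.finite_singleton (none : n.Trans)).union (((Set.finite_lt_nat i).preimage
      hinj.injOn).image some)).subset ?_
    rintro (_ | t) ht
    · exact Or.inl rfl
    · exact Or.inr ⟨t, ht, rfl⟩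
  refine ⟨
    { net := n
      mapS := Sum.elim P.mapS Sigma.fst
      mapT := fun t => Option.elim t τ P.mapT
      post_le_one := ?_
      post_unique := ?_
      pre_le_one := ?_
      pre_unique := ?_
      init_eq_one := ?_
      init_eq_zero := ?_
      acyclic := hR.acyclic
      finite_past := hR.finite_past hRf
      map_init := ?_
      map_pre := ?_
      map_post := ?_ }, Sum.inl, some, none, ?_, ?_, rfl, ?_⟩
  · rintro (x | x) (_ | t)
    · exact zero_le_one
    · exact P.post_le_one _ _
    · exact le_rfl
    · exact zero_le_one
  · rintro (x | x) (_ | t) (_ | t') h1 h2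
    · rfl
    · exact absurd h1 (lt_irrefl 0)
    · exact absurd h2 (lt_irrefl 0)
    · exact congrArg some (P.post_unique _ _ _ h1 h2)
    · rfl
    · exact absurd h2 (lt_irrefl 0)
    · exact absurd h1 (lt_irrefl 0)
    · exact absurd h1 (lt_irrefl 0)
  · rintro (x | x) (_ | t)
    · show (if x ∈ X then 1 else 0) ≤ 1
      split_ifs <;> omega
    · exact P.pre_le_one _ _
    · exact zero_le_one
    · exact zero_le_one
  · have key : ∀ x t, 0 < P.net.pre t x → ¬ 0 < (if x ∈ X then 1 else 0) := by
      intro x t h1 h2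
      split_ifs at h2 with h3
      · exact h1.ne' (hXpre x h3 t)
      · exact lt_irrefl _ h2
    rintro (x | x) (_ | t) (_ | t') h1 h2
    · rfl
    · exact absurd h1 (key x t' h2)
    · exact absurd h2 (key x t h1)
    · exact congrArg some (P.pre_unique _ _ _ h1 h2)
    · exact absurd h1 (lt_irrefl 0)
    · exact absurd h1 (lt_irrefl 0)
    · exact absurd h1 (lt_irrefl 0)
    · exact absurd h1 (lt_irrefl 0)
  · rintro (x | x) h
    · exact P.init_eq_one x fun t => h (some t)
    · exact absurd (h none) one_ne_zero
  · rintro (x | x) ⟨_ | t, h⟩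
    · exact absurd h (lt_irrefl 0)
    · exact P.init_eq_zero x ⟨t, h⟩
    · rfl
    · rfl
  · intro s
    rw [P.map_init, ← (Sum.inl_injective (β := Σ s, Fin (N.post τ s))).encard_image]
    congr 1
    ext (x | x)
    · exact ⟨fun ⟨y, hy, e⟩ => Sum.inl_injective e ▸ hy, fun hx => ⟨x, hx, rfl⟩⟩
    · exact ⟨fun ⟨y, hy, e⟩ => absurd e Sum.inl_ne_inr, fun hx => absurd hx.2 zero_ne_one⟩
  · rintro (_ | t) s
    · refine (hτ s).trans ?_
      rw [← (Sum.inl_injective (β := Σ s, Fin (N.post τ s))).encard_image]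
      congr 1
      ext (x | x)
      · constructor
        · rintro ⟨y, hy, e⟩
          obtain rfl := Sum.inl_injective e
          exact ⟨hy.1, by simp [n, hy.2]⟩
        · rintro ⟨h1, h2⟩
          refine ⟨x, ⟨h1, ?_⟩, rfl⟩
          by_contra h
          simp [n, h] at h2
      · exact ⟨fun ⟨y, hy, e⟩ => absurd e Sum.inl_ne_inr, fun hx => absurd hx.2 (lt_irrefl 0)⟩
    · refine (P.map_pre t s).trans ?_
      rw [← (Sum.inl_injective (β := Σ s, Fin (N.post τ s))).encard_image]
      congr 1
      ext (x | x)
      · exact ⟨fun ⟨y, hy, e⟩ => Sum.inl_injective e ▸ hy, fun hx => ⟨x, hx, rfl⟩⟩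
      · exact ⟨fun ⟨y, hy, e⟩ => absurd e Sum.inl_ne_inr, fun hx => absurd hx.2 (lt_irrefl 0)⟩
  · rintro (_ | t) s
    · have hi : Function.Injective fun i : Fin (N.post τ s) =>
          (Sum.inr ⟨s, i⟩ : P.net.Place ⊕ Σ s, Fin (N.post τ s)) := fun i j h => by
        simpa using h
      have h1 := hi.encard_image Set.univ
      rw [Set.encard_univ, ENat.card_eq_coe_fintype_card, Fintype.card_fin] at h1
      refine h1.symm.trans ?_
      congr 1
      ext (x | ⟨s', i⟩)
      · exact ⟨fun ⟨y, hy, e⟩ => absurd e Sum.inr_ne_inl, fun hx => absurd hx.2 (lt_irrefl 0)⟩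
      · constructor
        · rintro ⟨y, hy, e⟩
          cases e
          exact ⟨rfl, zero_lt_one⟩
        · rintro ⟨h2, -⟩
          obtain rfl : s' = s := h2
          exact ⟨i, trivial, rfl⟩
    · refine (P.map_post t s).trans ?_
      rw [← (Sum.inl_injective (β := Σ s, Fin (N.post τ s))).encard_image]
      congr 1
      ext (x | x)
      · exact ⟨fun ⟨y, hy, e⟩ => Sum.inl_injective e ▸ hy, fun hx => ⟨x, hx, rfl⟩⟩
      · exact ⟨fun ⟨y, hy, e⟩ => absurd e Sum.inl_ne_inr, fun hx => absurd hx.2 (lt_irrefl 0)⟩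
  · refine ⟨Sum.inl_injective, Option.some_injective _, fun _ => rfl, ?_, fun _ _ => rfl,
      fun _ _ => rfl, fun _ => rfl, fun _ => rfl⟩
    rintro (x | x) hx
    · exact absurd ⟨x, rfl⟩ hx
    · rfl
  · rintro ⟨t, ht⟩
    cases ht
  · intro x
    show 0 < (if x ∈ X then 1 else 0) ↔ x ∈ X
    split_ifs with h <;> simp [h]

end GRProc

/-! ### Keeping a set of places unconsumed. -/

open Classical in
-- Since `a` and `b` differ, each occurs once in `{a, b}`, so both restrictions can fire, and hence
-- so can the pair. For `a = b` the restriction would be the whole multiset, and conflict-freeness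
-- would say nothing.
theorem PTNet.BinaryConflictFree.pre_add_pre_le {N : PTNet.{u}} (hcf : N.BinaryConflictFree)
    {M : N.Place → ℕ} (hM : N.Reachable M) {a b : N.Trans} (hab : a ≠ b)
    (ha : ∀ s, N.pre a s ≤ M s) (hb : ∀ s, N.pre b s ≤ M s) (s : N.Place) :
    N.pre a s + N.pre b s ≤ M s := by
  have h1 := hcf {a, b} (by simp) M hM
  have h2 : N.CanFire M {a, b} := by
    by_contra h
    refine h1 ⟨fun t ht => ?_, h⟩
    rw [PTNet.canFire_iff]
    rcases (by simpa using ht : t = a ∨ t = b) with rfl | rfl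
    · have : Multiset.count t {t, b} = 1 := by simp [hab]
      rw [this]
      exact ⟨by simp, fun s => by simpa [PTNet.preM] using ha s⟩
    · have : Multiset.count t {a, t} = 1 := by
        simp [hab.symm]
      rw [this]
      exact ⟨by simp, fun s => by simpa [PTNet.preM] using hb s⟩
  simpa [PTNet.preM] using ((PTNet.canFire_iff _ _ _).1 h2).2 s

namespace GRProc

variable {N : PTNet.{u}}

/-- Initial segments of the linearisation beyond rank `j` are finite and causally closed, and they
absorb every finite set of transitions. -/
theorem toRun_rePre_of_rank {P : GRProc N} {r : P.net.Trans → ℕ} (hr : P.net.Ranks r)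
    (hinj : Function.Injective r) {pr : P.net.Trans → P.net.Place → ℕ} (h : P.IsPre pr)
    (hr' : (P.rePre pr h).net.Ranks r) (j : ℕ)
    (H : ∀ m, j ≤ m → ∀ (hD : P.DownClosed {t | r t < m})
      (hD' : (P.rePre pr h).DownClosed {t | r t < m}),
      SwapStar (P.restrict _ hD) ((P.rePre pr h).restrict _ hD')) :
    P.toRun = (P.rePre pr h).toRun := by
  refine toRun_rePre h fun E hE => ?_
  refine ⟨{t | r t < max j (hE.toFinset.sup r + 1)}, downClosed_lt hr _, downClosed_lt hr' _,
    fun t ht => ?_, (Set.finite_lt_nat _).preimage hinj.injOn, H _ (le_max_left _ _) _ _⟩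
  exact lt_of_lt_of_le (Nat.lt_succ_of_le (Finset.le_sup (hE.mem_toFinset.2 ht)))
    (le_max_right _ _)

/-- The presets `pr` are obtained from those of `P` by swaps that change no transition of rank
less than `k`, such that no transition of rank less than `i` consumes a place in `X`. -/
def Avoids (P : GRProc N) (r : P.net.Trans → ℕ) (k : ℕ) (X : Set P.net.Place) (i : ℕ)
    (pr : P.net.Trans → P.net.Place → ℕ) : Prop :=
  ∃ h : P.IsPre pr, (P.rePre pr h).net.Ranks r ∧ (∀ w, r w < k → pr w = P.net.pre w) ∧
    (∀ w, r w < i → ∀ x ∈ X, pr w x = 0) ∧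
    ∀ m, max i k ≤ m → ∀ (hD : P.DownClosed {t | r t < m})
      (hD' : (P.rePre pr h).DownClosed {t | r t < m}),
      SwapStar (P.restrict _ hD) ((P.rePre pr h).restrict _ hD')

/-- Some process that differs from `P` by swaps only, and not in the transitions of rank less than
`k`, has a further transition labelled `τ` that consumes `X`. -/
def Occurs (P : GRProc N) (r : P.net.Trans → ℕ) (k : ℕ) (X : Set P.net.Place) (τ : N.Trans) :
    Prop :=
  ∃ (pr : P.net.Trans → P.net.Place → ℕ) (h : P.IsPre pr), P.toRun = (P.rePre pr h).toRun ∧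
    (∀ w, r w < k → pr w = P.net.pre w) ∧
    ∃ v, k ≤ r v ∧ P.mapT v = τ ∧ ∀ x, 0 < pr v x ↔ x ∈ X

/-- The transition `v` of rank `i` and `τ` are both enabled in the marking of the cut at `i`, `τ` by
the tokens on `X`. Equal labels would allow `v` to consume `X`, which `ho` excludes. For different
labels the two can fire together, so enough tokens outside `X` remain for `v`. -/
theorem Avoids.step (hcf : N.BinaryConflictFree) {P : GRProc N} {r : P.net.Trans → ℕ}
    (hr : P.net.Ranks r) (hinj : Function.Injective r) {k : ℕ} {X : Set P.net.Place}
    (hX : X ⊆ P.cut r k) {τ : N.Trans}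
    (hτ : ∀ s, (N.pre τ s : ℕ∞) = {x | P.mapS x = s ∧ x ∈ X}.encard)
    (ho : ¬ P.Occurs r k X τ) {i : ℕ} {pr : P.net.Trans → P.net.Place → ℕ}
    (hpr : P.Avoids r k X i pr) :
    ∃ pr', P.Avoids r k X (i + 1) pr' ∧ ∀ w, r w < i → pr' w = pr w := by
  obtain ⟨h, h1, h2, h3, h4⟩ := hpr
  by_cases hv : ∃ v, r v = i ∧ k ≤ r v
  · obtain ⟨v, rfl, hk⟩ := hv
    let P1 := P.rePre pr h
    obtain ⟨M, hM, hMs⟩ := exists_reachable (P := P1) h1 hinj (r v)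
    have hX1 : X ⊆ P1.cut r (r v) := fun x hx =>
      ⟨InPlaces.mono (P := P1) (fun t (ht : r t < k) => ht.trans_le hk) (hX hx).1, fun w hw => by
        by_contra hc
        exact hw.ne' (h3 w (not_le.1 hc) x hx)⟩
    have hXs : ∀ s, {x | P1.mapS x = s ∧ x ∈ X} ⊆ {x | P1.mapS x = s ∧ x ∈ P1.cut r (r v)} :=
      fun s x hx => ⟨hx.1, hX1 hx.2⟩
    have hd := fun s => Set.encard_diff_eq_coe_sub (hXs s) (hMs s) (hτ s)
    have hvM : ∀ s, N.pre (P.mapT v) s ≤ M s := fun s => by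
      have := Set.encard_le_encard (show {x | P1.mapS x = s ∧ 0 < P1.net.pre v x} ⊆
        {x | P1.mapS x = s ∧ x ∈ P1.cut r (r v)} from
          fun x hx => ⟨hx.1, mem_cut_of_pre h1 hx.2⟩)
      rw [← hMs, ← P1.map_pre] at this
      exact_mod_cast this
    have retarget : ∀ W ⊆ P1.cut r (r v),
        (∀ s, (N.pre (P.mapT v) s : ℕ∞) = {x | P.mapS x = s ∧ x ∈ W}.encard) →
        ∃ (pr' : P.net.Trans → P.net.Place → ℕ) (h' : P.IsPre pr'), (P.rePre pr' h').net.Ranks r ∧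
          (∀ w, r w < r v → pr' w = pr w) ∧ (∀ x, 0 < pr' v x ↔ x ∈ W) ∧
          ∀ m, r v ≤ m → ∀ (hD : P.DownClosed {t | r t < m})
            (hD' : (P.rePre pr' h').DownClosed {t | r t < m}),
            SwapStar (P.restrict _ hD) ((P.rePre pr' h').restrict _ hD') := by
      intro W hW hWc
      obtain ⟨pr', h', g1, g2, g3, g4⟩ := exists_retarget _ P1 r h1 v W hW hWc rfl
      refine ⟨pr', ⟨h'.fin, h'.ne, h'.le_one, h'.unique, h'.acyclic, h'.finite_past, h'.map_pre⟩,
        g1, g2, g3, fun m hm hD hD' => ?_⟩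
      exact Relation.ReflTransGen.trans (h4 m (max_le hm (hk.trans hm)) hD (downClosed_lt h1 m))
        (g4 m hm _ hD')
    by_cases hτv : P.mapT v = τ
    · obtain ⟨pr', h', g1, g2, g3, g4⟩ := retarget X hX1 (hτv ▸ hτ)
      exact absurd ⟨pr', h', toRun_rePre_of_rank hr hinj h' g1 _ g4,
        fun w hw => (g2 w (hw.trans_le hk)).trans (h2 w hw), v, hk, hτv, g3⟩ ho
    · have hle := fun s => hcf.pre_add_pre_le hM hτv hvM (fun s => (hd s).1) s
      -- The new preset of `v` is chosen outside `X` for each label separately, then reassembled as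
      -- `{x | x ∈ W (P.mapS x)}`.
      have hW : ∀ s, ∃ W ⊆ {x | P1.mapS x = s ∧ x ∈ P1.cut r (r v)} \ {x | P1.mapS x = s ∧ x ∈ X},
          W.encard = (N.pre (P.mapT v) s : ℕ∞) := fun s => by
        refine Set.exists_subset_encard_eq ?_
        rw [(hd s).2]
        have := hle s
        exact_mod_cast (by omega : N.pre (P.mapT v) s ≤ M s - N.pre τ s)
      choose W hW hWc using hW
      obtain ⟨pr', h', g1, g2, g3, g4⟩ := retarget {x | x ∈ W (P.mapS x)}
        (fun x hx => (hW _ hx).1.2) (fun s => by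
          rw [← hWc]
          congr 1
          ext x
          constructor
          · intro hx
            have : P.mapS x = s := (hW s hx).1.1
            exact ⟨this, show x ∈ W (P.mapS x) from this ▸ hx⟩
          · rintro ⟨rfl, hx⟩
            exact hx)
      refine ⟨pr', ⟨h', g1, fun w hw => (g2 w (hw.trans_le hk)).trans (h2 w hw), ?_,
        fun m hm => g4 m ((Nat.le_succ _).trans ((le_max_left _ _).trans hm))⟩, g2⟩
      intro w hw x hx
      rcases Nat.lt_succ_iff_lt_or_eq.1 hw with hw | hw
      · rw [g2 w hw, h3 w hw x hx]
      · obtain rfl := hinj hw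
        by_contra hc
        have hxW : x ∈ W (P.mapS x) := (g3 x).1 (Nat.pos_of_ne_zero hc)
        exact (hW _ hxW).2 ⟨rfl, hx⟩
  -- Nothing has to change: a transition of rank `i`, if there is one, has rank below `k`, and such
  -- transitions consume no place of the cut at `k`.
  · refine ⟨pr, ⟨h, h1, h2, fun w hw x hx => ?_, fun m hm => h4 m
      ((max_le_max_right k (Nat.le_succ i)).trans hm)⟩, fun _ _ => rfl⟩
    by_cases hwk : r w < k
    · rw [h2 w hwk]
      by_contra hc
      exact absurd ((hX hx).2 w (Nat.pos_of_ne_zero hc)) (not_le.2 hwk)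
    · refine h3 w (lt_of_le_of_ne (Nat.lt_succ_iff.1 hw) fun e => hv ⟨w, e, not_lt.1 hwk⟩) x hx

theorem exists_avoids_seq (hcf : N.BinaryConflictFree) {P : GRProc N} {r : P.net.Trans → ℕ}
    (hr : P.net.Ranks r) (hinj : Function.Injective r) {k : ℕ} {X : Set P.net.Place}
    (hX : X ⊆ P.cut r k) {τ : N.Trans}
    (hτ : ∀ s, (N.pre τ s : ℕ∞) = {x | P.mapS x = s ∧ x ∈ X}.encard)
    (ho : ¬ P.Occurs r k X τ) : ∃ (seq : ℕ → P.net.Trans → P.net.Place → ℕ),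
      (∀ i, P.Avoids r k X i (seq i)) ∧ ∀ i w, r w < i → seq (i + 1) w = seq i w := by
  have h0 : P.Avoids r k X 0 P.net.pre := ⟨P.isPre_self, hr, fun _ _ => rfl,
    fun _ h => absurd h (Nat.not_lt_zero _), fun _ _ _ _ => Relation.ReflTransGen.refl⟩
  choose next hn1 hn2 using fun (i : ℕ) (pr : {pr // P.Avoids r k X i pr}) =>
    Avoids.step hcf hr hinj hX hτ ho pr.2
  let seq : ∀ i, {pr // P.Avoids r k X i pr} := fun i =>
    Nat.rec ⟨_, h0⟩ (fun i pr => ⟨next i pr, hn1 i pr⟩) i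
  exact ⟨fun i => (seq i).1, fun i => (seq i).2, fun i w hw => hn2 i (seq i) w hw⟩

/-- The limit of the sequence from `exists_avoids_seq`: the preset of `w` is constant from stage `r
w + 1` on. Conditions on finitely many transitions hold in the limit because they hold at a late
enough stage. -/
theorem exists_rePre_avoiding (hcf : N.BinaryConflictFree) {P : GRProc N} {r : P.net.Trans → ℕ}
    (hr : P.net.Ranks r) (hinj : Function.Injective r) {k : ℕ} {X : Set P.net.Place}
    (hX : X ⊆ P.cut r k) {τ : N.Trans}
    (hτ : ∀ s, (N.pre τ s : ℕ∞) = {x | P.mapS x = s ∧ x ∈ X}.encard)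
    (ho : ¬ P.Occurs r k X τ) :
    ∃ (pr : P.net.Trans → P.net.Place → ℕ) (h : P.IsPre pr), (P.rePre pr h).net.Ranks r ∧
      P.toRun = (P.rePre pr h).toRun ∧ (∀ w, r w < k → pr w = P.net.pre w) ∧
      ∀ w, ∀ x ∈ X, pr w x = 0 := by
  obtain ⟨seq, hseq, hstep⟩ := exists_avoids_seq hcf hr hinj hX hτ ho
  have hagree : ∀ w i, r w < i → seq i w = seq (r w + 1) w := by
    intro w i hi
    induction i, Nat.succ_le_of_lt hi using Nat.le_induction with
    | base => rfl
    | succ i hwi ih => exact (hstep i w hwi).trans (ih hwi)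
  have hpre : ∀ i, P.IsPre (seq i) := fun i => (hseq i).1
  let pr : P.net.Trans → P.net.Place → ℕ := fun w => seq (r w + 1) w
  have hfin : ∀ t, {s | 0 < pr t s}.Finite := fun t => (hpre _).fin t
  have hne : ∀ t, {s | 0 < pr t s}.Nonempty := fun t => (hpre _).ne t
  have hR : (P.net.rePre pr hfin hne).Ranks r := fun t x v h1 h2 =>
    (hseq (r v + 1)).2.1 t x v h1 h2
  have h : P.IsPre pr :=
    { fin := hfin
      ne := hne
      le_one := fun s t => (hpre _).le_one s t
      unique := fun s t t' ht ht' => by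
        refine (hpre (max (r t) (r t') + 1)).unique s t t' ?_ ?_
        · rw [hagree t _ (Nat.lt_succ_of_le (le_max_left _ _))]
          exact ht
        · rw [hagree t' _ (Nat.lt_succ_of_le (le_max_right _ _))]
          exact ht'
      acyclic := hR.acyclic
      finite_past := hR.finite_past fun i => (Set.finite_lt_nat i).preimage hinj.injOn
      map_pre := fun t s => (hpre _).map_pre t s }
  refine ⟨pr, h, hR, toRun_rePre_of_rank hr hinj h hR k fun m hm hD hD' => ?_,
    fun w hw => (hseq _).2.2.1 w hw, fun w x hx => (hseq _).2.2.2.1 w (Nat.lt_succ_self _) x hx⟩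
  -- On transitions of rank below `m` the limit agrees with stage `m`, which finitely many swaps
  -- connect to `P`.
  obtain ⟨h1, h2, -, -, h5⟩ := hseq m
  refine Relation.ReflTransGen.tail (h5 m (max_le le_rfl hm) hD (downClosed_lt h2 m)) (Or.inl ?_)
  refine ⟨Equiv.refl _, Equiv.refl _, fun _ => rfl, fun t s => ?_, fun _ _ => rfl, fun _ => rfl,
    fun _ => rfl⟩
  exact congrFun (hagree t.1 m t.2).symm s.1

/-! ### Extending an equivalent process beyond its run. -/

/-- If `A` is obtained from a prefix of `P` by adding a single transition, and the class of `A` is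
not in the run of `P`, then a process equivalent to `P` has an extension with prefix `A`. -/
theorem exists_extension_of_restrict_prefix (hN : N.IsCountable) (hcf : N.BinaryConflictFree)
    {A P : GRProc N} (hA : A.IsFinite) (hAP : FinBD.mk A hA ∉ P.toRun) {t : A.net.Trans}
    (ht : ∀ v x, 0 < A.net.post t x → A.net.pre v x = 0)
    (hB : (A.restrict _ (downClosed_compl ht)).Prefix P) :
    ∃ P' : GRProc N, P'.toRun = P.toRun ∧ ∃ Q : GRProc N, P'.Prefix Q ∧ A.Prefix Q := by
  obtain ⟨f, g, h⟩ := hB.exists_isEmb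
  have hBf : (A.restrict _ (downClosed_compl ht)).IsFinite :=
    have : Finite A.net.Trans := hA
    A.restrict_isFinite _ (Set.toFinite _)
  obtain ⟨r, k, hinj, hr, hk⟩ := exists_rank hN P (@Set.finite_range _ _ g hBf) h.downClosed
  have hgk : ∀ w, r (g w) < k := fun w => (hk _).1 ⟨w, rfl⟩
  have hpl : ∀ x, 0 < A.net.pre t x → A.InPlaces {t}ᶜ x := fun x hx =>
    inPlaces_compl_iff.2 fun h' => hx.ne' (ht t x h')
  let X : Set P.net.Place := f '' {x | 0 < A.net.pre t x.1}
  have hfX : ∀ x, f x ∈ X ↔ 0 < A.net.pre t x.1 := fun x => h.injS.mem_set_image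
  have hXin : ∀ x, P.InPlaces {w | r w < k} (f x) := fun x =>
    inPlaces_of_producers fun w hw => (hk w).1 (h.mem_range_of_post hw)
  have hXcut : X ⊆ P.cut r k := by
    rintro _ ⟨x, hx, rfl⟩
    refine ⟨hXin x, fun w hw => ?_⟩
    by_contra hc
    obtain ⟨w, rfl⟩ := (hk w).2 (not_le.1 hc)
    rw [h.pre] at hw
    -- The only consumer of such a place in `A` is `t`, which is not in the prefix.
    exact w.2 (A.pre_unique _ _ _ hw hx)
  have hτ : ∀ s, (N.pre (A.mapT t) s : ℕ∞) = {x | P.mapS x = s ∧ x ∈ X}.encard := fun s => by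
    rw [A.map_pre, ← Set.encard_subtype_setOf (S := A.InPlaces {t}ᶜ)
      (fun x => A.mapS x = s ∧ 0 < A.net.pre t x) fun x hx => hpl x hx.2]
    rw [← h.injS.encard_image]
    congr 1
    ext y
    constructor
    · rintro ⟨x, ⟨h1, h2⟩, rfl⟩
      exact ⟨(h.mapS x).trans h1, x, h2, rfl⟩
    · rintro ⟨h1, x, h2, rfl⟩
      exact ⟨x, ⟨(h.mapS x).symm.trans h1, h2⟩, rfl⟩
  have hemb : ∀ pr (hp : P.IsPre pr), (∀ w, r w < k → pr w = P.net.pre w) →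
      IsEmb (A.restrict _ (downClosed_compl ht)) (P.rePre pr hp) f g := fun pr hp hk' =>
    ⟨h.injS, h.injT, h.init, h.init_zero,
      fun w x => (congrFun (hk' _ (hgk w)) (f x)).trans (h.pre w x), h.post, h.mapS, h.mapT⟩
  -- A transition of this kind would complete the prefix to a copy of `A` within a process that has
  -- the run of `P`.
  have ho : ¬ P.Occurs r k X (A.mapT t) := by
    rintro ⟨pr, hp, h1, h2, v, h3, h4, h5⟩
    refine hAP (h1 ▸ mem_toRun_of_prefix hA ?_)
    refine prefix_of_restrict ht (hemb pr hp h2) (v := v) ?_ h4 fun x => ?_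
    · rintro ⟨w, rfl⟩
      exact absurd (hgk w) (not_lt.2 h3)
    · exact pre_eq_of_pos_iff (P := P.rePre pr hp) (Q := A) ((h5 _).trans (hfX x))
  obtain ⟨pr, hp, h1, h2, h3, h4⟩ := exists_rePre_avoiding hcf hr hinj hXcut hτ ho
  have hXfin : X.Finite := Set.Finite.image _ (Set.Finite.preimage (f := Subtype.val)
    Subtype.val_injective.injOn (A.net.pre_finite t))
  have hXne : X.Nonempty := by
    obtain ⟨x, hx⟩ := A.net.pre_nonempty t
    exact ⟨_, ⟨x, hpl x hx⟩, hx, rfl⟩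
  obtain ⟨Q, F, G, v, hQ, hv, hl, hvX⟩ := exists_extension (P.rePre pr hp) h1 hinj hXfin hXne
    (k := k) (fun x hx => (hXcut hx).1) (fun x hx w => h4 w x hx) hτ
  refine ⟨P.rePre pr hp, h2.symm, Q, hQ.prefix, ?_⟩
  refine prefix_of_restrict ht (hQ.comp (hemb pr hp h3)) (v := v) ?_ hl fun x => ?_
  · rintro ⟨w, rfl⟩
    exact hv ⟨_, rfl⟩
  · exact pre_eq_of_pos_iff ((hvX _).trans (hfX x))

/-- Induction on the size of a finite process `A` outside the run, removing a maximal transition as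
long as the rest is still outside. At the first smaller process inside the run,
`exists_extension_of_restrict_prefix` applies. -/
theorem exists_proper_extension (hN : N.IsCountable) (hcf : N.BinaryConflictFree) {P : GRProc N}
    (h : ¬ IsMaximalBDRun P.toRun) :
    ∃ P' : GRProc N, P'.SwapEquiv P ∧ ∃ Q : GRProc N, P'.Prefix Q ∧ ¬ P'.SwapEquiv Q := by
  have key : ∀ n, ∀ (A : GRProc N) (hA : A.IsFinite), Nat.card A.net.Trans = n →
      FinBD.mk A hA ∉ P.toRun →
      ∃ P' : GRProc N, P'.SwapEquiv P ∧ ∃ Q : GRProc N, P'.Prefix Q ∧ ¬ P'.SwapEquiv Q := by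
    intro n
    induction n with
    | zero =>
      intro A hA hn hAP
      have : Finite A.net.Trans := hA
      have := Finite.card_eq_zero_iff.1 hn
      exact absurd (mem_toRun_of_prefix hA (prefix_of_isEmpty P)) hAP
    | succ n ih =>
      intro A hA hn hAP
      have : Finite A.net.Trans := hA
      have : Nonempty A.net.Trans := (Nat.card_pos_iff.1 (by omega)).1
      obtain ⟨t, ht⟩ := exists_maximal_trans hA
      have hBf : (A.restrict _ (downClosed_compl ht)).IsFinite :=
        A.restrict_isFinite _ (Set.toFinite _)
      by_cases hB : FinBD.mk _ hBf ∈ P.toRun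
      · obtain ⟨P1, h1, h2⟩ := exists_prefix_of_mem_toRun hB
        obtain ⟨P', h3, Q, h4, h5⟩ :=
          exists_extension_of_restrict_prefix hN hcf hA (h1 ▸ hAP) ht h2
        refine ⟨P', h3.trans h1, Q, h4, fun h6 => hAP ?_⟩
        -- If the extension had the same run, its prefix `A` would belong to the run of `P`.
        rw [← h1, ← h3, show P'.toRun = Q.toRun from h6]
        exact mem_toRun_of_prefix hA h5
      · refine ih _ hBf ?_ hB
        have h1 : Nat.card A.net.Trans = ({t}ᶜ : Set A.net.Trans).ncard + 1 := by
          rw [← Set.ncard_add_ncard_compl {t}, Set.ncard_singleton, add_comm]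
        have h2 : Nat.card {w // w ∈ ({t}ᶜ : Set A.net.Trans)} = ({t}ᶜ : Set A.net.Trans).ncard :=
          Nat.card_coe_set_eq _
        exact h2.trans (by omega)
  obtain ⟨A, hA, hAP⟩ := exists_not_mem_toRun h
  exact key _ A hA rfl hAP

end GRProc

theorem mainTheorem6 (N : PTNet.{u}) (hcount : N.IsCountable) (hcf : N.BinaryConflictFree)
    (P : GRProc N) :
    (¬ IsMaximalBDRun P.toRun →
      ∃ P' : GRProc N, P'.SwapEquiv P ∧ ∃ Q : GRProc N, P'.Prefix Q ∧ ¬ P'.SwapEquiv Q) ∧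
    ((BDProc.mk P).IsMaximal → (BDProc.mk P).IsRunMaximal) := by
  refine ⟨GRProc.exists_proper_extension hcount hcf, fun hm => ?_⟩
  by_contra hc
  obtain ⟨P', h1, Q, h2, h3⟩ := GRProc.exists_proper_extension hcount hcf (P := P) hc
  exact h3 (hm P' (Quotient.sound (s := swapSetoid N) h1) Q h2)
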